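/- **Theorem (DFuzz metric preservation).** *Language.* Consider the terminating fragment of DFuzz with probabilities only over $\mathbb{R}$. Index kinds are $\mathsf n$ (sizes, in $\mathbb{N}$) and $\mathsf r$ (sensitivities, in $[0,\infty]$); sizes are $S ::= i\mid 0\mid S+1$, sensitivities $R ::= i\mid S\mid r\in\mathbb{R}^{\ge 0}\mid\infty\mid R+R\mid R\cdot R$, and types $$\sigma,\tau ::= \mathbb{R}\mid\mathbb{R}[R]\mid \mathsf{list}\,\sigma[S]\mid {!_R}\sigma\multimap\tau\mid\forall i{:}\kappa.\,\sigma\mid \mathsf M\mathbb{R}.$$ Here $\phi$ is an environment of index variables with kinds, $\Phi$ a finite list of constraints $S_1=S_2$ between sizes, $\Gamma$ an environment of declarations $x:{!_R}\sigma$; $R\cdot\Gamma$ multiplies all sensitivities of $\Gamma$ by $R$, and $\Gamma+\Gamma'$ adds the sensitivities of common variables (which must have equal types) and keeps the other declarations. The judgement $\phi;\Phi;\Gamma\vdash_D e:\tau$ is generated by the rules (with $\phi;\Phi$ omitted where it does not change, and $i$ always fresh): * $\Gamma,x:{!_1}\sigma\vdash x:\sigma$; $\ \Gamma\vdash r:\mathbb{R}[r]$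 for $r\in\mathbb{R}^{\ge0}$; $\ \Gamma\vdash \mathsf{nil}:\mathsf{list}\,\sigma[0]$; from $\Gamma\vdash e:\sigma$ and $\Gamma'\vdash e':\mathsf{list}\,\sigma[S]$ infer $\Gamma+\Gamma'\vdash e::e':\mathsf{list}\,\sigma[S+1]$; * from $\Gamma,x:{!_R}\sigma\vdash e:\tau$ infer $\Gamma\vdash\lambda x.e:{!_R}\sigma\multimap\tau$; from $\Gamma\vdash e_1:{!_R}\sigma\multimap\tau$ and $\Gamma'\vdash e_2:\sigma$ infer $\Gamma+R\cdot\Gamma'\vdash e_1\,e_2:\tau$; * from $\phi,i{:}\kappa;\Phi;\Gamma\vdash e:\sigma$ infer $\Gamma\vdash\Lambda i.e:\forall i{:}\kappa.\sigma$; from $\Gamma\vdash e:\forall i{:}\kappa.\sigma$ and an index term $I$ of kind $\kappa$ over $\phi$ infer $\Gamma\vdash e[I]:\sigma[I/i]$; * from $\Gamma,f:{!_\infty}({!_R}\sigma\multimap\tau),x:{!_R}\sigma\vdash e:\tau$ infer $\infty\cdot\Gamma\vdash\mathsf{letrec}\,f\,x=e:{!_R}\sigma\multimap\tau$; from $\phi,i{:}\kappa;\Phi;\Gamma,f:{!_\infty}(\forall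 i{:}\kappa.\sigma)\vdash e:\sigma$ infer $\infty\cdot\Gamma\vdash\mathsf{letrec}\,f\,i=e:\forall i{:}\kappa.\sigma$; both under the termination guard below; * from $\Gamma'\vdash e:\mathsf{list}\,\sigma[S]$, $\ \phi;\Phi,S=0;\Gamma\vdash e_1:\tau$ and $\phi,i{:}\mathsf n;\Phi,S=i+1;\Gamma,x:{!_R}\sigma,xs:{!_R}\mathsf{list}\,\sigma[i]\vdash e_2:\tau$ infer $\Gamma+R\cdot\Gamma'\vdash\mathsf{case}\,e\,[\mathsf{nil}\Rightarrow e_1\mid x::xs_{[i]}\Rightarrow e_2]:\tau$; * from $\Gamma\vdash e:\mathbb{R}$ infer $\infty\cdot\Gamma\vdash\mathsf{return}\,e:\mathsf M\mathbb{R}$; from $\Gamma\vdash e_1:\mathsf M\mathbb{R}$ and $\Gamma',x:{!_\infty}\mathbb{R}\vdash e_2:\mathsf M\mathbb{R}$ infer $\Gamma+\Gamma'\vdash\mathsf{let}\,x=e_1\,\mathsf{in}\,e_2:\mathsf M\mathbb{R}$; * subsumption: the type of $e$ may be replaced by a supertype, and $\Gamma$ may be replaced by an environment with additional declarations, larger sensitivities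 and subtypes. Subtyping is structural (in ${!_R}\sigma\multimap\tau$ it is contravariant in $\sigma$, covariant in $\tau$, and $R$ may grow), allows $\mathbb{R}[R]\sqsubseteq\mathbb{R}$, and identifies size and precision indices that are equal under all index valuations satisfying $\Phi$; inequalities of sensitivities are likewise required under all these valuations. *Semantics.* The erasure $|\sigma|$ is the simple type obtained by forgetting sensitivities and index information ($|\forall i{:}\kappa.\sigma| = \kappa^*\to|\sigma|$ with $\mathsf n^*=\mathbb{N}$, $\mathsf r^*=[0,\infty]$), interpreted set-theoretically, with $\mathsf M\mathbb{R}$ the discrete probability distributions on $\mathbb{R}$. The translation $e^*$ of $e$ into simply typed PCF (with lists and the distribution monad) turns $\Lambda i.e$ into $\lambda i.e^*$, $e[I]$ into $e^*\,I^*$ and the branch $x::xs_{[i]}\Rightarrow e_2$ into $x::xs\Rightarrow e_2^*\{\mathsf{sz}(xs)/i\}$, and is otherwise homomorphic. A recursive definition denotes $\bigcup_n F^n(\bot)$, where $F$ is the operator on functions given by its body, $\bot$ is the nowhere defined function, and $F^n(\bot)$ has a value at given arguments (as many as the type takes) if $F^n(g)$ has this value for every function $g$. The termination guard of a recursive definition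 requires that this union is a total function for every valuation of its free variables. *Distances.* Distances lie in $[0,\infty)\cup\{\bot\}$ with $\bot$ largest and subtraction truncated at $0$. Put $s\diamond\infty=\infty\diamond s=\infty$ for all sensitivities $s$ (this interprets $R\cdot R$); for a distance $d$ put $s\diamond\bot=\bot$ for all $s$, $\infty\diamond0=0$, $\infty\diamond d=\bot$ for $d\ne0$, and $s\diamond d=s\,d$ otherwise. For a valuation $\theta$ of $\phi$, define $\mathfrak D_{[\![\tau]\!]_\theta}$ on $|\tau|$, with indices evaluated at $\theta$, by: $|a-b|$ on $\mathbb{R}$; on $\mathbb{R}[R]$, $0$ if $a=b=R$ and $\bot$ otherwise; on $\mathsf{list}\,\sigma[S]$, the sum of the distances of corresponding entries if both lengths equal $S$, and $\bot$ otherwise; on ${!_R}\sigma\multimap\tau$, $\sup_{a,b\in|\sigma|}\bigl(\mathfrak D_\tau(f\,a,g\,b)-R\diamond\mathfrak D_\sigma(a,b)\bigr)$; on $\forall i{:}\kappa.\sigma$, $\sup_{d\in\kappa^*}\mathfrak D_{\sigma[d/i]}(f\,d,g\,d)$; on $\mathsf M\mathbb{R}$, $\sup_{x}|\ln(\mu(x)/\nu(x))|$,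 where the term is $0$ if $\mu(x)=\nu(x)=0$ and $\bot$ if exactly one of them is $0$. Finally $\mathfrak D_{[\![\Gamma]\!]_\theta}(\theta_1,\theta_2)=\sum_{x:{!_R}\sigma\in\Gamma}[\![R]\!]_\theta\diamond\mathfrak D_{[\![\sigma]\!]_\theta}(\theta_1(x),\theta_2(x))$. *Claim.* If $\phi;\Phi;\Gamma\vdash_D e:\tau$, $\theta$ is a valuation of $\phi$ that satisfies $\Phi$, and $\theta_1,\theta_2$ are any two valuations of the term variables (mapping each $x$ with $x:{!_R}\sigma\in\Gamma$ into the interpretation of $|\sigma|$), then $$\mathfrak D_{[\![\tau]\!]_\theta}\bigl([\![e^*]\!]_{\theta_1,\theta},[\![e^*]\!]_{\theta_2,\theta}\bigr)\le\mathfrak D_{[\![\Gamma]\!]_\theta}(\theta_1,\theta_2).$$ -/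

import Mathlib

open scoped ENNReal NNReal

noncomputable section

namespace DFuzz

/-! ### Kinds, simple types and their interpretation -/

/-- Kinds of index terms: `r` (sensitivities) and `n` (sizes). -/
inductive Kind : Type
  | r
  | n

/-- Sizes are natural numbers; sensitivities are elements of `[0, ∞]`. -/
abbrev Kind.den : Kind → Type
  | .r => ℝ≥0∞
  | .n => ℕ

/-- Simple types of the target language. `idx κ` is the type `κ*` of index values
(`ℕ` for `n`, extended nonnegative reals for `r`); `dist` is the type of discrete probability
distributions over the reals. -/
inductive STy : Type
  | idx (κ : Kind)
  | real
  | list (A : STy)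
  | dist
  | fn (A B : STy)

/-- Set-theoretic interpretation of simple types. -/
abbrev STy.den : STy → Type
  | .idx κ => κ.den
  | .real => ℝ
  | .list A => List A.den
  | .dist => PMF ℝ
  | .fn A B => A.den → B.den

/-- Every simple type is inhabited. -/
def STy.default : (A : STy) → A.den
  | .idx .r => (0 : ℝ≥0∞)
  | .idx .n => (0 : ℕ)
  | .real => (0 : ℝ)
  | .list _ => []
  | .dist => PMF.pure 0
  | .fn _ B => fun _ => B.default

/-! ### Typed de Bruijn variables and valuations -/

/-- `Var l a`: a variable of sort `a` in the scope `l`. -/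
inductive Var {α : Type} : List α → α → Type
  | zero {l : List α} {a : α} : Var (a :: l) a
  | succ {l : List α} {a b : α} : Var l a → Var (b :: l) a

/-- A family that assigns to every variable of the scope `l` something of the right sort. -/
abbrev Asg {α : Type} (D : α → Type) (l : List α) : Type :=
  ∀ a : α, Var l a → D a

namespace Asg

variable {α : Type} {D : α → Type}

def nil : Asg D ([] : List α) := fun _ x => nomatch x

/-- Extension of an assignment by a value for the newest variable. -/
def cons {l : List α} {a : α} (d : D a) (h : Asg D l) : Asg D (a :: l)
  | _, .zero => d
  | _, .succ x => h _ x

def tail {l : List α} {a : α} (h : Asg D (a :: l)) : Asg D l :=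
  fun _ x => h _ (.succ x)

def append : {l m : List α} → Asg D l → Asg D m → Asg D (l ++ m)
  | [], _, _, k => k
  | _ :: _, _, h, k => cons (h _ .zero) (append (tail h) k)

end Asg

/-- Valuations of term variables. -/
abbrev Env (K : List STy) : Type := Asg STy.den K

/-- Valuations of index variables. -/
abbrev IEnv (φ : List Kind) : Type := Asg Kind.den φ

/-- An index valuation seen as a valuation of ordinary variables of the types `κ*`. -/
def IEnv.toEnv : {φ : List Kind} → IEnv φ → Env (φ.map STy.idx)
  | [], _ => Asg.nil
  | κ :: _, θ => Asg.cons (D := STy.den) (a := STy.idx κ) (θ κ .zero) (toEnv (Asg.tail θ))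

/-! ### Arithmetic of sensitivities and distances -/

/-- The product `⋄` of two sensitivities: `s ⋄ ∞ = ∞ ⋄ s = ∞` (also for `s = 0`), and the usual
product of finite sensitivities. -/
def sensMul (s t : ℝ≥0∞) : ℝ≥0∞ :=
  open Classical in if s = ⊤ ∨ t = ⊤ then ⊤ else s * t

/-- The product `s ⋄ d` of a sensitivity and a distance: `s ⋄ ⊥ = ⊥` (also for `s = 0`),
`∞ ⋄ 0 = 0`, `∞ ⋄ d = ⊥` for `d ≠ 0`, and the usual product otherwise. The infinite distance
`⊥` is `⊤ : ℝ≥0∞`. -/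
def distMul (s d : ℝ≥0∞) : ℝ≥0∞ :=
  open Classical in if d = ⊤ then ⊤ else s * d

/-! ### The target language: simply typed PCF with lists and distributions -/

/-- Well-typed expressions of the target language, in a scope `K`. In `case e e₁ e₂` the branch
`e₂` binds the head and then the tail (the tail is the newest variable). In `letrec e` the body
binds the recursive function and then its argument (the argument is the newest variable). -/
inductive Tm : List STy → STy → Type
  | var {K : List STy} {A : STy} : Var K A → Tm K A
  | real {K : List STy} : ℝ → Tm K .real
  | sens {K : List STy} : ℝ≥0∞ → Tm K (.idx .r)
  | zero {K : List STy} : Tm K (.idx .n)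
  | succ {K : List STy} : Tm K (.idx .n) → Tm K (.idx .n)
  | toSens {K : List STy} : Tm K (.idx .n) → Tm K (.idx .r)
  | add {K : List STy} : Tm K (.idx .r) → Tm K (.idx .r) → Tm K (.idx .r)
  | mul {K : List STy} : Tm K (.idx .r) → Tm K (.idx .r) → Tm K (.idx .r)
  | nil {K : List STy} {A : STy} : Tm K (.list A)
  | cons {K : List STy} {A : STy} : Tm K A → Tm K (.list A) → Tm K (.list A)
  | sz {K : List STy} {A : STy} : Tm K (.list A) → Tm K (.idx .n)
  | case {K : List STy} {A B : STy} :
      Tm K (.list A) → Tm K B → Tm (.list A :: A :: K) B → Tm K B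
  | lam {K : List STy} {A B : STy} : Tm (A :: K) B → Tm K (.fn A B)
  | app {K : List STy} {A B : STy} : Tm K (.fn A B) → Tm K A → Tm K B
  | letrec {K : List STy} {A B : STy} : Tm (A :: .fn A B :: K) B → Tm K (.fn A B)
  | unitM {K : List STy} : Tm K .real → Tm K .dist
  | bindM {K : List STy} : Tm K .dist → Tm (.real :: K) .dist → Tm K .dist

/-- Renamings of variables. -/
abbrev Ren (K L : List STy) : Type := Asg (Var L) K

def Ren.lift {K L : List STy} {A : STy} (ρ : Ren K L) : Ren (A :: K) (A :: L) :=
  Asg.cons (D := Var (A :: L)) .zero (fun B x => .succ (ρ B x))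

def Ren.wk {K : List STy} {A : STy} : Ren K (A :: K) := fun _ x => .succ x

def Tm.ren : {K : List STy} → {A : STy} → Tm K A → {L : List STy} → Ren K L → Tm L A
  | _, _, .var x, _, ρ => .var (ρ _ x)
  | _, _, .real a, _, _ => .real a
  | _, _, .sens s, _, _ => .sens s
  | _, _, .zero, _, _ => .zero
  | _, _, .succ t, _, ρ => .succ (t.ren ρ)
  | _, _, .toSens t, _, ρ => .toSens (t.ren ρ)
  | _, _, .add t u, _, ρ => .add (t.ren ρ) (u.ren ρ)
  | _, _, .mul t u, _, ρ => .mul (t.ren ρ) (u.ren ρ)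
  | _, _, .nil, _, _ => .nil
  | _, _, .cons t u, _, ρ => .cons (t.ren ρ) (u.ren ρ)
  | _, _, .sz t, _, ρ => .sz (t.ren ρ)
  | _, _, .case t u v, _, ρ => .case (t.ren ρ) (u.ren ρ) (v.ren ρ.lift.lift)
  | _, _, .lam t, _, ρ => .lam (t.ren ρ.lift)
  | _, _, .app t u, _, ρ => .app (t.ren ρ) (u.ren ρ)
  | _, _, .letrec t, _, ρ => .letrec (t.ren ρ.lift.lift)
  | _, _, .unitM t, _, ρ => .unitM (t.ren ρ)
  | _, _, .bindM t u, _, ρ => .bindM (t.ren ρ) (u.ren ρ.lift)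

/-- `Settles B u d`: the stages `u 0, u 1, …`, each of which depends on an unknown `g : X`, settle
on `d : B.den`. At a type that is not a function type, some stage has the value `d` whatever `g`
is; at a function type this is required after application to every argument. -/
def Settles {X : Type} : (B : STy) → (ℕ → X → B.den) → B.den → Prop
  | .fn A B, u, d => ∀ a : A.den, Settles B (fun k g => u k g a) (d a)
  | .idx _, u, d => ∃ k, ∀ g, u k g = d
  | .real, u, d => ∃ k, ∀ g, u k g = d
  | .list _, u, d => ∃ k, ∀ g, u k g = d
  | .dist, u, d => ∃ k, ∀ g, u k g = d

/-- `IsUnion F d` says that the total function `d` is `⋃ₖ Fᵏ(⊥)`, where `⊥` is the nowhere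
defined function: since `F` is a map on total functions, `Fᵏ(⊥)` has the value `v` at given
arguments when `Fᵏ(g)` has that value for all functions `g`. -/
def IsUnion {A B : STy} (F : (STy.fn A B).den → (STy.fn A B).den) (d : (STy.fn A B).den) : Prop :=
  Settles (.fn A B) (fun k g => F^[k] g) d

/-- The function `⋃ₖ Fᵏ(⊥)`; an arbitrary function if this union is not total. -/
def fixpoint {A B : STy} (F : (STy.fn A B).den → (STy.fn A B).den) : (STy.fn A B).den :=
  open Classical in if h : ∃ d, IsUnion F d then h.choose else (STy.fn A B).default

/-- Denotational semantics of the target language. -/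
def Tm.den : {K : List STy} → {A : STy} → Tm K A → Env K → A.den
  | _, _, .var x, k => k _ x
  | _, _, .real a, _ => a
  | _, _, .sens s, _ => s
  | _, _, .zero, _ => (0 : ℕ)
  | _, _, .succ t, k => ((t.den k : ℕ) + 1 : ℕ)
  | _, _, .toSens t, k => ((t.den k : ℕ) : ℝ≥0∞)
  | _, _, .add t u, k => ((t.den k : ℝ≥0∞) + (u.den k : ℝ≥0∞) : ℝ≥0∞)
  | _, _, .mul t u, k => sensMul (t.den k) (u.den k)
  | _, _, .nil, _ => []
  | _, _, .cons t u, k => List.cons (t.den k) (u.den k)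
  | _, _, .sz t, k => List.length (t.den k)
  | _, _, .case (A := A) t u v, k =>
      match (t.den k : List A.den) with
      | [] => u.den k
      | x :: xs =>
        v.den (Asg.cons (D := STy.den) (a := .list A) xs (Asg.cons (D := STy.den) (a := A) x k))
  | _, _, .lam t, k => fun a => t.den (Asg.cons a k)
  | _, _, .app t u, k => (t.den k) (u.den k)
  | _, _, .letrec (A := A) (B := B) t, k =>
      fixpoint (fun g a =>
        t.den (Asg.cons a (Asg.cons (D := STy.den) (a := .fn A B) g k)))
  | _, _, .unitM t, k => PMF.pure (t.den k : ℝ)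
  | _, _, .bindM t u, k =>
      PMF.bind (t.den k : PMF ℝ) (fun a => u.den (Asg.cons (D := STy.den) (a := .real) a k))

/-- The termination guard of a recursive definition: its unfoldings `Fᵏ(⊥)` add up to a total
function, for every valuation of its free variables. (No condition on other expressions.) -/
def Tm.SNGuard : {K : List STy} → {A : STy} → Tm K A → Prop
  | K, _, .letrec (A := A) (B := B) t =>
      ∀ k : Env K, ∃ d, IsUnion (fun g a =>
        t.den (Asg.cons a (Asg.cons (D := STy.den) (a := .fn A B) g k))) d
  | _, _, _ => True

/-! ### Index terms of DFuzz -/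

/-- Sizes (`Idx φ .n`) and sensitivities (`Idx φ .r`) over the index variables `φ`. -/
inductive Idx (φ : List Kind) : Kind → Type
  | var {κ : Kind} : Var φ κ → Idx φ κ
  | zero : Idx φ .n
  | succ : Idx φ .n → Idx φ .n
  | size : Idx φ .n → Idx φ .r
  | const : ℝ≥0 → Idx φ .r
  | infty : Idx φ .r
  | add : Idx φ .r → Idx φ .r → Idx φ .r
  | mul : Idx φ .r → Idx φ .r → Idx φ .r

def Idx.den {φ : List Kind} (θ : IEnv φ) : {κ : Kind} → Idx φ κ → κ.den
  | _, .var i => θ _ i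
  | _, .zero => (0 : ℕ)
  | _, .succ S => (S.den θ : ℕ) + 1
  | _, .size S => ((S.den θ : ℕ) : ℝ≥0∞)
  | _, .const a => (a : ℝ≥0∞)
  | _, .infty => (⊤ : ℝ≥0∞)
  | _, .add R R' => (R.den θ : ℝ≥0∞) + (R'.den θ : ℝ≥0∞)
  | _, .mul R R' => sensMul (R.den θ) (R'.den θ)

/-- Substitutions for index variables. -/
abbrev ISub (φ ψ : List Kind) : Type := Asg (Idx ψ) φ

def Idx.subst {φ ψ : List Kind} (s : ISub φ ψ) : {κ : Kind} → Idx φ κ → Idx ψ κ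
  | _, .var i => s _ i
  | _, .zero => .zero
  | _, .succ S => .succ (S.subst s)
  | _, .size S => .size (S.subst s)
  | _, .const a => .const a
  | _, .infty => .infty
  | _, .add R R' => .add (R.subst s) (R'.subst s)
  | _, .mul R R' => .mul (R.subst s) (R'.subst s)

/-- Weakening by a fresh index variable, as a substitution. -/
def ISub.wk {φ : List Kind} {κ : Kind} : ISub φ (κ :: φ) := fun _ i => .var (.succ i)

/-- The substitution `[I/i]` for the newest index variable. -/
def ISub.inst {φ : List Kind} {κ : Kind} (I : Idx φ κ) : ISub (κ :: φ) φ :=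
  Asg.cons I (fun _ i => .var i)

def ISub.lift {φ ψ : List Kind} {κ : Kind} (s : ISub φ ψ) : ISub (κ :: φ) (κ :: ψ) :=
  Asg.cons (.var .zero) (fun κ' i => (s κ' i).subst ISub.wk)

/-- Constraints `S₁ = S₂` between sizes. -/
structure Constr (φ : List Kind) : Type where
  lhs : Idx φ .n
  rhs : Idx φ .n

def Constr.wk {φ : List Kind} {κ : Kind} (c : Constr φ) : Constr (κ :: φ) :=
  ⟨c.lhs.subst ISub.wk, c.rhs.subst ISub.wk⟩

def Constr.Holds {φ : List Kind} (θ : IEnv φ) (c : Constr φ) : Prop :=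
  c.lhs.den θ = c.rhs.den θ

/-- `θ ⊨ Φ`. -/
def Models {φ : List Kind} (θ : IEnv φ) (Φ : List (Constr φ)) : Prop :=
  ∀ c ∈ Φ, c.Holds θ

/-! ### Types and environments of DFuzz -/

/-- `Ty φ A`: the DFuzz types over the index variables `φ` whose erasure is the simple type `A`.
The constructors are `ℝ`, `ℝ[R]`, `list σ [S]`, `!_R σ ⊸ τ`, `∀ i : κ. σ` and `M ℝ`. -/
inductive Ty : List Kind → STy → Type
  | real {φ : List Kind} : Ty φ .real
  | preal {φ : List Kind} : Idx φ .r → Ty φ .real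
  | list {φ : List Kind} {A : STy} : Ty φ A → Idx φ .n → Ty φ (.list A)
  | lolli {φ : List Kind} {A B : STy} : Idx φ .r → Ty φ A → Ty φ B → Ty φ (.fn A B)
  | all {φ : List Kind} {A : STy} (κ : Kind) : Ty (κ :: φ) A → Ty φ (.fn (.idx κ) A)
  | mreal {φ : List Kind} : Ty φ .dist

def Ty.subst : {φ : List Kind} → {A : STy} → Ty φ A → {ψ : List Kind} → ISub φ ψ → Ty ψ A
  | _, _, .real, _, _ => .real
  | _, _, .preal R, _, s => .preal (R.subst s)
  | _, _, .list σ S, _, s => .list (σ.subst s) (S.subst s)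
  | _, _, .lolli R σ τ, _, s => .lolli (R.subst s) (σ.subst s) (τ.subst s)
  | _, _, .all κ σ, _, s => .all κ (σ.subst s.lift)
  | _, _, .mreal, _, _ => .mreal

def Ty.wk {φ : List Kind} {κ : Kind} {A : STy} (σ : Ty φ A) : Ty (κ :: φ) A := σ.subst ISub.wk

/-- `|ln (p / q)|` for two probabilities, with value `0` if both vanish and `⊥` if exactly one
vanishes. -/
def logRatio (p q : ℝ≥0∞) : ℝ≥0∞ :=
  open Classical in
  if p = 0 ∧ q = 0 then 0
  else if p = 0 ∨ q = 0 then ⊤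
  else ENNReal.ofReal |Real.log (p.toReal / q.toReal)|

/-- The metric `𝒟_σ` of a type at the index valuation `θ`. Distances are extended nonnegative
reals, so the difference in the clause for functions is truncated at `0`. -/
def Ty.dist : {φ : List Kind} → {A : STy} → Ty φ A → IEnv φ → A.den → A.den → ℝ≥0∞
  | _, _, .real, _ => fun (a b : ℝ) => ENNReal.ofReal |a - b|
  | _, _, .preal R, θ => fun (a b : ℝ) =>
      open Classical in
      let ρ : ℝ≥0∞ := R.den θ
      if ρ ≠ ⊤ ∧ a = ρ.toReal ∧ b = ρ.toReal then 0 else ⊤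
  | _, _, .list (A := A) σ S, θ => fun (l m : List A.den) =>
      let s : ℕ := S.den θ
      if l.length = s ∧ m.length = s then (List.zipWith (σ.dist θ) l m).sum else ⊤
  | _, _, .lolli R σ τ, θ => fun f g =>
      ⨆ a, ⨆ b, (τ.dist θ (f a) (g b) - distMul (R.den θ) (σ.dist θ a b))
  | _, _, .all κ σ, θ => fun f g =>
      ⨆ d : κ.den, σ.dist (Asg.cons d θ) (f d) (g d)
  | _, _, .mreal, _ => fun (μ ν : PMF ℝ) => ⨆ x : ℝ, logRatio (μ x) (ν x)

/-- Environments over the term variables in scope: each variable is either declared, as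
`x :!_R σ` (constructor `cons`), or not in the domain of the environment (constructor `skip`). -/
inductive Ctx (φ : List Kind) : List STy → Type
  | nil : Ctx φ []
  | skip {G : List STy} {A : STy} : Ctx φ G → Ctx φ (A :: G)
  | cons {G : List STy} {A : STy} : Ctx φ G → Idx φ .r → Ty φ A → Ctx φ (A :: G)

namespace Ctx

def wk {φ : List Kind} {κ : Kind} : {G : List STy} → Ctx φ G → Ctx (κ :: φ) G
  | _, nil => nil
  | _, skip Γ => skip Γ.wk
  | _, cons Γ R σ => cons Γ.wk (R.subst ISub.wk) σ.wk

/-- `R · Γ`. -/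
def scale {φ : List Kind} (R : Idx φ .r) : {G : List STy} → Ctx φ G → Ctx φ G
  | _, nil => nil
  | _, skip Γ => skip (scale R Γ)
  | _, cons Γ R' σ => cons (scale R Γ) (.mul R R') σ

/-- `Sum Γ Γ' Γ''` is `Γ + Γ' = Γ''`. -/
inductive Sum {φ : List Kind} : {G : List STy} → Ctx φ G → Ctx φ G → Ctx φ G → Prop
  | nil : Sum nil nil nil
  | skip {G : List STy} {A : STy} {Γ Γ' Γ'' : Ctx φ G} :
      Sum Γ Γ' Γ'' → Sum (skip (A := A) Γ) (skip Γ') (skip Γ'')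
  | left {G : List STy} {A : STy} {Γ Γ' Γ'' : Ctx φ G} {R : Idx φ .r} {σ : Ty φ A} :
      Sum Γ Γ' Γ'' → Sum (cons Γ R σ) (skip Γ') (cons Γ'' R σ)
  | right {G : List STy} {A : STy} {Γ Γ' Γ'' : Ctx φ G} {R : Idx φ .r} {σ : Ty φ A} :
      Sum Γ Γ' Γ'' → Sum (skip Γ) (cons Γ' R σ) (cons Γ'' R σ)
  | both {G : List STy} {A : STy} {Γ Γ' Γ'' : Ctx φ G} {R R' : Idx φ .r} {σ : Ty φ A} :
      Sum Γ Γ' Γ'' → Sum (cons Γ R σ) (cons Γ' R' σ) (cons Γ'' (.add R R') σ)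

/-- `Has Γ x R σ`: the declaration `x :!_R σ` occurs in `Γ`. -/
inductive Has {φ : List Kind} :
    {G : List STy} → {A : STy} → Ctx φ G → Var G A → Idx φ .r → Ty φ A → Prop
  | here {G : List STy} {A : STy} {Γ : Ctx φ G} {R : Idx φ .r} {σ : Ty φ A} :
      Has (cons Γ R σ) .zero R σ
  | skip {G : List STy} {A B : STy} {Γ : Ctx φ G} {x : Var G A} {R : Idx φ .r} {σ : Ty φ A} :
      Has Γ x R σ → Has (skip (A := B) Γ) (.succ x) R σ
  | cons {G : List STy} {A B : STy} {Γ : Ctx φ G} {x : Var G A} {R R' : Idx φ .r}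
      {σ : Ty φ A} {τ : Ty φ B} :
      Has Γ x R σ → Has (cons Γ R' τ) (.succ x) R σ

/-- The distance `∑_{x :!_R σ ∈ Γ} R ⋄ 𝒟_σ(θ₁ x, θ₂ x)` of two valuations. -/
def dist {φ : List Kind} (θ : IEnv φ) : {G : List STy} → Ctx φ G → Env G → Env G → ℝ≥0∞
  | _, nil, _, _ => 0
  | _, skip Γ, θ₁, θ₂ => Γ.dist θ θ₁.tail θ₂.tail
  | _, cons Γ R σ, θ₁, θ₂ =>
      Γ.dist θ θ₁.tail θ₂.tail + distMul (R.den θ) (σ.dist θ (θ₁ _ .zero) (θ₂ _ .zero))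

end Ctx

/-! ### Expressions of DFuzz and their translation -/

/-- Expressions of DFuzz with index variables `φ` and term variables `G`, annotated with erased
types. `num a` is a numeral, `letrec e` is `letrec f x. e` (the argument is the newest variable),
`letrecI e` is `letrec f i. e` for an index variable `i`, `ilam e` is `Λ i. e`, `iapp e I` is
`e[I]`, and `case e e₁ e₂` is `case e [nil ⇒ e₁ | x :: xs_[i] ⇒ e₂]` (`xs` is the newest term
variable and `i` the newest index variable of `e₂`). -/
inductive Exp : List Kind → List STy → STy → Type
  | var {φ : List Kind} {G : List STy} {A : STy} : Var G A → Exp φ G A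
  | num {φ : List Kind} {G : List STy} : ℝ≥0 → Exp φ G .real
  | lam {φ : List Kind} {G : List STy} {A B : STy} : Exp φ (A :: G) B → Exp φ G (.fn A B)
  | app {φ : List Kind} {G : List STy} {A B : STy} :
      Exp φ G (.fn A B) → Exp φ G A → Exp φ G B
  | letrec {φ : List Kind} {G : List STy} {A B : STy} :
      Exp φ (A :: .fn A B :: G) B → Exp φ G (.fn A B)
  | letrecI {φ : List Kind} {G : List STy} {κ : Kind} {A : STy} :
      Exp (κ :: φ) (.fn (.idx κ) A :: G) A → Exp φ G (.fn (.idx κ) A)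
  | ilam {φ : List Kind} {G : List STy} {κ : Kind} {A : STy} :
      Exp (κ :: φ) G A → Exp φ G (.fn (.idx κ) A)
  | iapp {φ : List Kind} {G : List STy} {κ : Kind} {A : STy} :
      Exp φ G (.fn (.idx κ) A) → Idx φ κ → Exp φ G A
  | nil {φ : List Kind} {G : List STy} {A : STy} : Exp φ G (.list A)
  | cons {φ : List Kind} {G : List STy} {A : STy} :
      Exp φ G A → Exp φ G (.list A) → Exp φ G (.list A)
  | case {φ : List Kind} {G : List STy} {A B : STy} :
      Exp φ G (.list A) → Exp φ G B → Exp (.n :: φ) (.list A :: A :: G) B → Exp φ G B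
  | ret {φ : List Kind} {G : List STy} : Exp φ G .real → Exp φ G .dist
  | bind {φ : List Kind} {G : List STy} :
      Exp φ G .dist → Exp φ (.real :: G) .dist → Exp φ G .dist

/-- Assignments of target expressions (in the scope `K`) to index variables. -/
abbrev IMap (φ : List Kind) (K : List STy) : Type := Asg (fun κ => Tm K (.idx κ)) φ

def IMap.wk {φ : List Kind} {K : List STy} {A : STy} (ι : IMap φ K) : IMap φ (A :: K) :=
  fun κ i => (ι κ i).ren Ren.wk

def IMap.cons {φ : List Kind} {K : List STy} {κ : Kind} (t : Tm K (.idx κ)) (ι : IMap φ K) :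
    IMap (κ :: φ) K :=
  Asg.cons (D := fun κ => Tm K (.idx κ)) t ι

/-- The translation `I*` of sizes and sensitivities. -/
def Idx.star {φ : List Kind} {K : List STy} (ι : IMap φ K) : {κ : Kind} → Idx φ κ → Tm K (.idx κ)
  | _, .var i => ι _ i
  | _, .zero => .zero
  | _, .succ S => .succ (S.star ι)
  | _, .size S => .toSens (S.star ι)
  | _, .const a => .sens a
  | _, .infty => .sens ⊤
  | _, .add R R' => .add (R.star ι) (R'.star ι)
  | _, .mul R R' => .mul (R.star ι) (R'.star ι)

/-- The translation `e*` with the term variables renamed by `ρ` and the index variables replaced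
by the expressions `ι`. In particular the branch `e₂` of a pattern matching becomes
`e₂* {sz(xs)/i}`. -/
def Exp.starWith : {φ : List Kind} → {G : List STy} → {A : STy} → Exp φ G A →
    {K : List STy} → Ren G K → IMap φ K → Tm K A
  | _, _, _, .var x, _, ρ, _ => .var (ρ _ x)
  | _, _, _, .num a, _, _, _ => .real (a : ℝ)
  | _, _, _, .lam e, _, ρ, ι => .lam (e.starWith ρ.lift ι.wk)
  | _, _, _, .app e e', _, ρ, ι => .app (e.starWith ρ ι) (e'.starWith ρ ι)
  | _, _, _, .letrec e, _, ρ, ι => .letrec (e.starWith ρ.lift.lift ι.wk.wk)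
  | _, _, _, .letrecI e, _, ρ, ι =>
      .letrec (e.starWith (fun B x => .succ (ρ.lift B x)) (IMap.cons (.var .zero) ι.wk.wk))
  | _, _, _, .ilam e, _, ρ, ι =>
      .lam (e.starWith (fun B x => .succ (ρ B x)) (IMap.cons (.var .zero) ι.wk))
  | _, _, _, .iapp e I, _, ρ, ι => .app (e.starWith ρ ι) (I.star ι)
  | _, _, _, .nil, _, _, _ => .nil
  | _, _, _, .cons e e', _, ρ, ι => .cons (e.starWith ρ ι) (e'.starWith ρ ι)
  | _, _, _, .case e e₁ e₂, _, ρ, ι =>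
      .case (e.starWith ρ ι) (e₁.starWith ρ ι)
        (e₂.starWith ρ.lift.lift (IMap.cons (.sz (.var .zero)) ι.wk.wk))
  | _, _, _, .ret e, _, ρ, ι => .unitM (e.starWith ρ ι)
  | _, _, _, .bind e e', _, ρ, ι => .bindM (e.starWith ρ ι) (e'.starWith ρ.lift ι.wk)

def Var.inl {l m : List STy} : {A : STy} → Var l A → Var (l ++ m) A
  | _, .zero => .zero
  | _, .succ x => .succ x.inl

def Var.inr {m : List STy} : (l : List STy) → {A : STy} → Var m A → Var (l ++ m) A
  | [], _, x => x
  | _ :: l, _, x => .succ (Var.inr l x)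

def Var.idx : {φ : List Kind} → {κ : Kind} → Var φ κ → Var (φ.map STy.idx) (.idx κ)
  | _, _, .zero => .zero
  | _, _, .succ i => .succ i.idx

/-- The translation `e*`. Its free variables are the term variables and the index variables
of `e`. -/
def Exp.star {φ : List Kind} {G : List STy} {A : STy} (e : Exp φ G A) :
    Tm (G ++ φ.map STy.idx) A :=
  e.starWith (fun _ x => x.inl) (fun _ i => .var (Var.inr G i.idx))

/-- The interpretation of `e*` at the joint valuation of term variables (`η`) and index
variables (`θ`). -/
def Exp.interp {φ : List Kind} {G : List STy} {A : STy} (e : Exp φ G A) (η : Env G)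
    (θ : IEnv φ) : A.den :=
  e.star.den (Asg.append η θ.toEnv)

/-! ### The type system of DFuzz -/

/-- Subtyping `φ; Φ ⊨ σ ⊑ τ`. -/
inductive Sub : {φ : List Kind} → List (Constr φ) → {A : STy} → Ty φ A → Ty φ A → Prop
  | real {φ : List Kind} {Φ : List (Constr φ)} : Sub Φ .real .real
  | mreal {φ : List Kind} {Φ : List (Constr φ)} : Sub Φ .mreal .mreal
  | preal {φ : List Kind} {Φ : List (Constr φ)} {R R' : Idx φ .r} :
      (∀ θ, Models θ Φ → R.den θ = R'.den θ) → Sub Φ (.preal R) (.preal R')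
  | forget {φ : List Kind} {Φ : List (Constr φ)} {R : Idx φ .r} : Sub Φ (.preal R) .real
  | list {φ : List Kind} {Φ : List (Constr φ)} {A : STy} {σ σ' : Ty φ A} {S S' : Idx φ .n} :
      Sub Φ σ σ' → (∀ θ, Models θ Φ → S.den θ = S'.den θ) → Sub Φ (.list σ S) (.list σ' S')
  | lolli {φ : List Kind} {Φ : List (Constr φ)} {A B : STy} {R R' : Idx φ .r}
      {σ σ' : Ty φ A} {τ τ' : Ty φ B} :
      (∀ θ, Models θ Φ → (R.den θ : ℝ≥0∞) ≤ R'.den θ) → Sub Φ σ' σ → Sub Φ τ τ' →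
      Sub Φ (.lolli R σ τ) (.lolli R' σ' τ')
  | all {φ : List Kind} {Φ : List (Constr φ)} {A : STy} {κ : Kind} {σ σ' : Ty (κ :: φ) A} :
      Sub (Φ.map Constr.wk) σ σ' → Sub Φ (.all κ σ) (.all κ σ')

/-- Subtyping `φ; Φ ⊨ Γ ⊑ Γ'` of environments, including weakening. -/
inductive Ctx.Sub {φ : List Kind} (Φ : List (Constr φ)) :
    {G : List STy} → Ctx φ G → Ctx φ G → Prop
  | nil : Ctx.Sub Φ .nil .nil
  | skip {G : List STy} {A : STy} {Γ Γ' : Ctx φ G} :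
      Ctx.Sub Φ Γ Γ' → Ctx.Sub Φ (.skip (A := A) Γ) (.skip Γ')
  | weaken {G : List STy} {A : STy} {Γ Γ' : Ctx φ G} {R : Idx φ .r} {σ : Ty φ A} :
      Ctx.Sub Φ Γ Γ' → Ctx.Sub Φ (.cons Γ R σ) (.skip Γ')
  | cons {G : List STy} {A : STy} {Γ Γ' : Ctx φ G} {R R' : Idx φ .r} {σ σ' : Ty φ A} :
      Ctx.Sub Φ Γ Γ' → (∀ θ, Models θ Φ → (R'.den θ : ℝ≥0∞) ≤ R.den θ) → DFuzz.Sub Φ σ σ' →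
      Ctx.Sub Φ (.cons Γ R σ) (.cons Γ' R' σ')

/-- The typing judgement `φ; Φ; Γ ⊢ e : τ` of the terminating fragment of DFuzz. -/
inductive HasType : {φ : List Kind} → List (Constr φ) → {G : List STy} → Ctx φ G →
    {A : STy} → Exp φ G A → Ty φ A → Prop
  | var {φ : List Kind} {Φ : List (Constr φ)} {G : List STy} {Γ : Ctx φ G} {A : STy}
      {x : Var G A} {σ : Ty φ A} :
      Γ.Has x (.const 1) σ → HasType Φ Γ (.var x) σ
  | num {φ : List Kind} {Φ : List (Constr φ)} {G : List STy} {Γ : Ctx φ G} {a : ℝ≥0} :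
      HasType Φ Γ (.num a) (.preal (.const a))
  | lam {φ : List Kind} {Φ : List (Constr φ)} {G : List STy} {Γ : Ctx φ G} {A B : STy}
      {e : Exp φ (A :: G) B} {R : Idx φ .r} {σ : Ty φ A} {τ : Ty φ B} :
      HasType Φ (.cons Γ R σ) e τ → HasType Φ Γ (.lam e) (.lolli R σ τ)
  | app {φ : List Kind} {Φ : List (Constr φ)} {G : List STy} {Γ Γ' Γ'' : Ctx φ G} {A B : STy}
      {e₁ : Exp φ G (.fn A B)} {e₂ : Exp φ G A} {R : Idx φ .r} {σ : Ty φ A} {τ : Ty φ B} :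
      HasType Φ Γ e₁ (.lolli R σ τ) → HasType Φ Γ' e₂ σ → Ctx.Sum Γ (Γ'.scale R) Γ'' →
      HasType Φ Γ'' (.app e₁ e₂) τ
  | letrec {φ : List Kind} {Φ : List (Constr φ)} {G : List STy} {Γ : Ctx φ G} {A B : STy}
      {e : Exp φ (A :: .fn A B :: G) B} {R : Idx φ .r} {σ : Ty φ A} {τ : Ty φ B} :
      HasType Φ (.cons (.cons Γ .infty (.lolli R σ τ)) R σ) e τ →
      (Exp.letrec e).star.SNGuard →
      HasType Φ (Γ.scale .infty) (.letrec e) (.lolli R σ τ)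
  | letrecI {φ : List Kind} {Φ : List (Constr φ)} {G : List STy} {Γ : Ctx φ G} {κ : Kind}
      {A : STy} {e : Exp (κ :: φ) (.fn (.idx κ) A :: G) A} {σ : Ty (κ :: φ) A} :
      HasType (Φ.map Constr.wk) (.cons Γ.wk .infty (Ty.all κ σ).wk) e σ →
      (Exp.letrecI e).star.SNGuard →
      HasType Φ (Γ.scale .infty) (.letrecI e) (.all κ σ)
  | ilam {φ : List Kind} {Φ : List (Constr φ)} {G : List STy} {Γ : Ctx φ G} {κ : Kind}
      {A : STy} {e : Exp (κ :: φ) G A} {σ : Ty (κ :: φ) A} :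
      HasType (Φ.map Constr.wk) Γ.wk e σ → HasType Φ Γ (.ilam e) (.all κ σ)
  | iapp {φ : List Kind} {Φ : List (Constr φ)} {G : List STy} {Γ : Ctx φ G} {κ : Kind}
      {A : STy} {e : Exp φ G (.fn (.idx κ) A)} {σ : Ty (κ :: φ) A} {I : Idx φ κ} :
      HasType Φ Γ e (.all κ σ) → HasType Φ Γ (.iapp e I) (σ.subst (ISub.inst I))
  | nil {φ : List Kind} {Φ : List (Constr φ)} {G : List STy} {Γ : Ctx φ G} {A : STy}
      {σ : Ty φ A} :
      HasType Φ Γ .nil (.list σ .zero)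
  | cons {φ : List Kind} {Φ : List (Constr φ)} {G : List STy} {Γ Γ' Γ'' : Ctx φ G} {A : STy}
      {e : Exp φ G A} {e' : Exp φ G (.list A)} {σ : Ty φ A} {S : Idx φ .n} :
      HasType Φ Γ e σ → HasType Φ Γ' e' (.list σ S) → Ctx.Sum Γ Γ' Γ'' →
      HasType Φ Γ'' (.cons e e') (.list σ (.succ S))
  | case {φ : List Kind} {Φ : List (Constr φ)} {G : List STy} {Γ Γ' Γ'' : Ctx φ G} {A B : STy}
      {e : Exp φ G (.list A)} {e₁ : Exp φ G B} {e₂ : Exp (.n :: φ) (.list A :: A :: G) B}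
      {σ : Ty φ A} {τ : Ty φ B} {S : Idx φ .n} {R : Idx φ .r} :
      HasType Φ Γ' e (.list σ S) →
      HasType (⟨S, .zero⟩ :: Φ) Γ e₁ τ →
      HasType (⟨S.subst ISub.wk, .succ (.var .zero)⟩ :: Φ.map Constr.wk)
        (.cons (.cons Γ.wk (R.subst ISub.wk) σ.wk) (R.subst ISub.wk)
          (.list σ.wk (.var .zero))) e₂ τ.wk →
      Ctx.Sum Γ (Γ'.scale R) Γ'' →
      HasType Φ Γ'' (.case e e₁ e₂) τ
  | ret {φ : List Kind} {Φ : List (Constr φ)} {G : List STy} {Γ : Ctx φ G}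
      {e : Exp φ G .real} :
      HasType Φ Γ e .real → HasType Φ (Γ.scale .infty) (.ret e) .mreal
  | bind {φ : List Kind} {Φ : List (Constr φ)} {G : List STy} {Γ Γ' Γ'' : Ctx φ G}
      {e : Exp φ G .dist} {e' : Exp φ (.real :: G) .dist} :
      HasType Φ Γ e .mreal → HasType Φ (.cons Γ' .infty .real) e' .mreal →
      Ctx.Sum Γ Γ' Γ'' → HasType Φ Γ'' (.bind e e') .mreal
  | sub {φ : List Kind} {Φ : List (Constr φ)} {G : List STy} {Γ Γ' : Ctx φ G} {A : STy}
      {e : Exp φ G A} {σ τ : Ty φ A} :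
      HasType Φ Γ' e σ → Ctx.Sub Φ Γ Γ' → Sub Φ σ τ → HasType Φ Γ e τ

end DFuzz

end

/-!
The inequality is proved by induction on the typing derivation; everything except recursion is a
direct estimate with the arithmetic of `⋄`. For `letrec` the induction hypothesis says that the
body `F` maps functions at distance `0` to functions at distance `0`. If some `g` has distance `0`
from itself, then so do all unfoldings `Fᵏ(g)`, and the recursive function is a pointwise eventual
value of these (`Stabilizes.distOver_le`).

Such a `g` need not exist: the type may be a function type with results in `ℝ[∞]`, where all
distances are `⊥`. One then has to show that the termination guard fails, although it only speaks
about total functions `g`, none of which respects the type. The idea is to treat `ℝ[∞]` as an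
abstract type. No typing rule depends on its metric, so the theorem is proved for all the metrics
`Ty.distOver P` at once, in which `ℝ[∞]` is an arbitrary discrete metric space `P` of real
numbers; the metric of the theorem is the case `P = ∅`.

For each type one of two things happens, independently of `P`
(`Ty.isUniform_or_isPointed`): either some element has distance `0` from itself for every `P`, or
the type is a copy of `ℝ[∞]` in the sense that its elements at finite distance determine a point of
`P`, and every point of `P` arises in this way. If `P = ∅` and a recursive definition has a type of
the second sort, while its environment has types of the first sort only, then the result for
`P = {0}` and `P = {1}`, at one and the same valuation, says that the recursive function determines
both `0` and `1`, which is absurd (`distOver_fixpoint_le`).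

Denotations are computed by `Exp.sem`, which agrees with the interpretation of the translation
(`Exp.interp_eq_sem`).
-/

noncomputable section

namespace DFuzz

/-! ### Direct semantics of expressions -/

/-- Extension of a valuation of term variables. -/
abbrev Env.cons {K : List STy} {A : STy} (a : A.den) (k : Env K) : Env (A :: K) :=
  Asg.cons (D := STy.den) (a := A) a k

/-- Extension of a valuation of index variables. -/
abbrev IEnv.cons {φ : List Kind} {κ : Kind} (d : κ.den) (θ : IEnv φ) : IEnv (κ :: φ) :=
  Asg.cons (D := Kind.den) (a := κ) d θ

/-- The denotation of an expression, by recursion on the expression itself instead of on its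
translation. -/
def Exp.sem : {φ : List Kind} → {G : List STy} → {A : STy} → Exp φ G A → Env G → IEnv φ → A.den
  | _, _, _, .var x, η, _ => η _ x
  | _, _, _, .num a, _, _ => (a : ℝ)
  | _, _, _, .lam e, η, θ => fun a => e.sem (Env.cons a η) θ
  | _, _, _, .app e e', η, θ => (e.sem η θ) (e'.sem η θ)
  | _, _, _, .letrec (A := A) (B := B) e, η, θ =>
      fixpoint (A := A) (B := B)
        (fun g a => e.sem (Env.cons a (Env.cons (A := .fn A B) g η)) θ)
  | _, _, _, .letrecI (κ := κ) (A := A) e, η, θ =>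
      fixpoint (A := .idx κ) (B := A)
        (fun g d => e.sem (Env.cons (A := .fn (.idx κ) A) g η) (IEnv.cons d θ))
  | _, _, _, .ilam e, η, θ => fun d => e.sem η (IEnv.cons d θ)
  | _, _, _, .iapp e I, η, θ => (e.sem η θ) (I.den θ)
  | _, _, _, .nil, _, _ => []
  | _, _, _, .cons e e', η, θ => List.cons (e.sem η θ) (e'.sem η θ)
  | _, _, _, .case (A := A) e e₁ e₂, η, θ =>
      match (e.sem η θ : List A.den) with
      | [] => e₁.sem η θ
      | x :: xs => e₂.sem (Env.cons (A := .list A) xs (Env.cons x η))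
          (IEnv.cons (κ := .n) xs.length θ)
  | _, _, _, .ret e, η, θ => PMF.pure (e.sem η θ : ℝ)
  | _, _, _, .bind e e', η, θ =>
      PMF.bind (e.sem η θ : PMF ℝ) (fun a => e'.sem (Env.cons (A := .real) a η) θ)

theorem Env.cons_comp_lift {K L : List STy} {A : STy} (ρ : Ren K L) (a : A.den) (k : Env L) :
    (fun B x => Env.cons a k B (ρ.lift B x)) = Env.cons a (fun B x => k B (ρ B x)) := by
  funext B x
  cases x <;> rfl

theorem Tm.den_ren {K : List STy} {A : STy} (t : Tm K A) :
    ∀ {L : List STy} (ρ : Ren K L) (k : Env L),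
      (t.ren ρ).den k = t.den (fun B x => k B (ρ B x)) := by
  induction t with
  | case t u v iht ihu ihv =>
    intro L ρ k
    simp only [Tm.ren, Tm.den, iht, ihu, ihv, Env.cons_comp_lift]
  | lam t ih => intro L ρ k; simp only [Tm.ren, Tm.den, ih, Env.cons_comp_lift]
  | letrec t ih => intro L ρ k; simp only [Tm.ren, Tm.den, ih, Env.cons_comp_lift]
  | bindM t u iht ihu => intro L ρ k; simp only [Tm.ren, Tm.den, iht, ihu, Env.cons_comp_lift]
  | _ => intro L ρ k; simp only [Tm.ren, Tm.den, *]

theorem IMap.den_wk {φ : List Kind} {K : List STy} {A : STy} (ι : IMap φ K) (a : A.den)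
    (k : Env K) :
    (fun κ i => ((ι.wk (A := A)) κ i).den (Env.cons a k)) = fun κ i => (ι κ i).den k := by
  funext κ i
  exact Tm.den_ren _ _ _

theorem IMap.den_cons {φ : List Kind} {K : List STy} {κ : Kind} (t : Tm K (.idx κ))
    (ι : IMap φ K) (k : Env K) :
    (fun κ' i => ((IMap.cons t ι) κ' i).den k) =
      IEnv.cons (κ := κ) (t.den k) (fun κ i => (ι κ i).den k) := by
  funext κ' i
  cases i <;> rfl

theorem Idx.den_star {φ : List Kind} {K : List STy} (ι : IMap φ K) (k : Env K) {κ : Kind}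
    (I : Idx φ κ) : (I.star ι).den k = I.den (fun κ i => (ι κ i).den k) := by
  induction I with
  | _ => simp only [Idx.star, Tm.den, Idx.den, *]

theorem Exp.den_starWith {φ : List Kind} {G : List STy} {A : STy} (e : Exp φ G A) :
    ∀ {K : List STy} (ρ : Ren G K) (ι : IMap φ K) (k : Env K),
      (e.starWith ρ ι).den k = e.sem (fun B x => k B (ρ B x)) (fun κ i => (ι κ i).den k) := by
  induction e with
  | lam e ih =>
    intro K ρ ι k
    simp only [Exp.starWith, Tm.den, Exp.sem, ih, Env.cons_comp_lift, IMap.den_wk]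
  | letrec e ih =>
    intro K ρ ι k
    simp only [Exp.starWith, Tm.den, Exp.sem, ih, Env.cons_comp_lift, IMap.den_wk]
  | letrecI e ih =>
    intro K ρ ι k
    simp only [Exp.starWith, Tm.den, Exp.sem, ih, IMap.den_wk, IMap.den_cons]
    congr 1; funext g a; congr 1
    exact Env.cons_comp_lift _ _ _
  | ilam e ih =>
    intro K ρ ι k
    simp only [Exp.starWith, Tm.den, Exp.sem, ih, IMap.den_wk, IMap.den_cons]
    rfl
  | iapp e I ih => intro K ρ ι k; simp only [Exp.starWith, Tm.den, Exp.sem, ih, Idx.den_star]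
  | case e e₁ e₂ ih ih₁ ih₂ =>
    intro K ρ ι k
    simp only [Exp.starWith, Tm.den, Exp.sem, ih, ih₁, ih₂, Env.cons_comp_lift, IMap.den_wk,
      IMap.den_cons]
    rfl
  | bind e e' ih ih' =>
    intro K ρ ι k
    simp only [Exp.starWith, Tm.den, Exp.sem, ih, ih', Env.cons_comp_lift, IMap.den_wk]
  | _ => intro K ρ ι k; simp only [Exp.starWith, Tm.den, Exp.sem, *]

theorem Asg.append_inl {G K : List STy} (η : Env G) (k : Env K) {A : STy} (x : Var G A) :
    Asg.append η k A x.inl = η A x := by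
  induction x with
  | zero => rfl
  | succ x ih => exact ih _

theorem Asg.append_inr {K : List STy} (k : Env K) {A : STy} (x : Var K A) :
    ∀ {G : List STy} (η : Env G), Asg.append η k A (Var.inr G x) = k A x
  | [], _ => rfl
  | _ :: _, η => Asg.append_inr k x η.tail

theorem IEnv.toEnv_idx {φ : List Kind} (θ : IEnv φ) {κ : Kind} (i : Var φ κ) :
    θ.toEnv _ i.idx = θ κ i := by
  induction i with
  | zero => rfl
  | succ i ih => exact ih _

theorem Exp.interp_eq_sem {φ : List Kind} {G : List STy} {A : STy} (e : Exp φ G A) (η : Env G)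
    (θ : IEnv φ) : e.interp η θ = e.sem η θ := by
  simp only [Exp.interp, Exp.star, Exp.den_starWith, Tm.den, Asg.append_inl, Asg.append_inr,
    IEnv.toEnv_idx]

theorem Exp.exists_isUnion_of_letrec_guard {φ : List Kind} {G : List STy} {A B : STy}
    {e : Exp φ (A :: .fn A B :: G) B} (h : (Exp.letrec e).star.SNGuard) (η : Env G)
    (θ : IEnv φ) :
    ∃ d, IsUnion (A := A) (B := B)
      (fun g a => e.sem (Env.cons a (Env.cons (A := .fn A B) g η)) θ) d := by
  have := h (Asg.append η θ.toEnv)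
  simpa only [Exp.den_starWith, Env.cons_comp_lift, IMap.den_wk, Tm.den, Asg.append_inl,
    Asg.append_inr, IEnv.toEnv_idx] using this

theorem Exp.exists_isUnion_of_letrecI_guard {φ : List Kind} {G : List STy} {κ : Kind} {A : STy}
    {e : Exp (κ :: φ) (.fn (.idx κ) A :: G) A} (h : (Exp.letrecI e).star.SNGuard) (η : Env G)
    (θ : IEnv φ) :
    ∃ d, IsUnion (A := .idx κ) (B := A)
      (fun g d => e.sem (Env.cons (A := .fn (.idx κ) A) g η) (IEnv.cons d θ)) d := by
  obtain ⟨d, hd⟩ := h (Asg.append η θ.toEnv)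
  refine ⟨d, ?_⟩
  convert hd using 3 with g a
  simp only [Exp.den_starWith, IMap.den_wk, IMap.den_cons, Tm.den, Asg.append_inr,
    IEnv.toEnv_idx]
  congr 1
  funext B x
  cases x with
  | zero => rfl
  | succ x => exact (Asg.append_inl η _ x).symm

/-! ### Arithmetic of sensitivities -/

theorem distMul_top_right (s : ℝ≥0∞) : distMul s ⊤ = ⊤ := by simp [distMul]

theorem distMul_of_ne_top (s : ℝ≥0∞) {d : ℝ≥0∞} (h : d ≠ ⊤) : distMul s d = s * d := by
  simp [distMul, h]

theorem distMul_zero (s : ℝ≥0∞) : distMul s 0 = 0 := by simp [distMul]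

theorem distMul_one (d : ℝ≥0∞) : distMul 1 d = d := by
  by_cases h : d = ⊤ <;> simp [distMul, h]

theorem distMul_top_of_ne_zero {d : ℝ≥0∞} (h : d ≠ 0) : distMul ⊤ d = ⊤ := by
  by_cases h' : d = ⊤ <;> simp [distMul, h, h']

theorem distMul_mono {s s' d d' : ℝ≥0∞} (hs : s ≤ s') (hd : d ≤ d') :
    distMul s d ≤ distMul s' d' := by
  by_cases h : d' = ⊤
  · simp [h, distMul_top_right]
  · rw [distMul_of_ne_top _ h, distMul_of_ne_top _ (ne_top_of_le_ne_top h hd)]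
    gcongr

theorem distMul_add (s d d' : ℝ≥0∞) : distMul s (d + d') = distMul s d + distMul s d' := by
  by_cases h : d = ⊤
  · simp [h, distMul_top_right]
  by_cases h' : d' = ⊤
  · simp [h', distMul_top_right]
  rw [distMul_of_ne_top _ h, distMul_of_ne_top _ h',
    distMul_of_ne_top _ (ENNReal.add_ne_top.2 ⟨h, h'⟩), mul_add]

theorem add_distMul (s s' d : ℝ≥0∞) : distMul (s + s') d = distMul s d + distMul s' d := by
  by_cases h : d = ⊤
  · simp [h, distMul_top_right]
  · simp only [distMul_of_ne_top _ h, add_mul]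

/-- The two sides differ when one of `s`, `t` is `∞` and the other is `0`. -/
theorem distMul_distMul_le (s t d : ℝ≥0∞) :
    distMul s (distMul t d) ≤ distMul (sensMul s t) d := by
  by_cases hd : d = ⊤
  · simp [hd, distMul_top_right]
  by_cases h0 : d = 0
  · simp [h0, distMul_zero]
  by_cases h : s = ⊤ ∨ t = ⊤
  · simp [sensMul, h, distMul_top_of_ne_zero h0]
  · have ht : t ≠ ⊤ := fun h' => h (.inr h')
    rw [distMul_of_ne_top _ hd, distMul_of_ne_top _ hd,
      distMul_of_ne_top _ (ENNReal.mul_ne_top ht hd)]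
    simp [sensMul, h, mul_assoc]

/-! ### Substitution of index terms -/

theorem Idx.den_subst {φ ψ : List Kind} (s : ISub φ ψ) (θ : IEnv ψ) {κ : Kind} (I : Idx φ κ) :
    (I.subst s).den θ = I.den (fun κ i => (s κ i).den θ) := by
  induction I with
  | _ => simp only [Idx.subst, Idx.den, *]

theorem Idx.den_wk {φ : List Kind} {κ κ' : Kind} (I : Idx φ κ) (d : κ'.den) (θ : IEnv φ) :
    (I.subst ISub.wk).den (IEnv.cons d θ) = I.den θ :=
  Idx.den_subst _ _ _

theorem ISub.den_lift {φ ψ : List Kind} {κ : Kind} (s : ISub φ ψ) (d : κ.den) (θ : IEnv ψ) :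
    (fun κ' i => ((s.lift (κ := κ)) κ' i).den (IEnv.cons d θ)) =
      IEnv.cons d (fun κ' i => (s κ' i).den θ) := by
  funext κ' i
  cases i with
  | zero => rfl
  | succ i => exact Idx.den_wk _ _ _

theorem ISub.den_inst {φ : List Kind} {κ : Kind} (I : Idx φ κ) (θ : IEnv φ) :
    (fun κ' i => (ISub.inst I κ' i).den θ) = IEnv.cons (I.den θ) θ := by
  funext κ' i
  cases i <;> rfl

theorem Models.cons_wk {φ : List Kind} {κ : Kind} {Φ : List (Constr φ)} {θ : IEnv φ}
    (h : Models θ Φ) (d : κ.den) : Models (IEnv.cons d θ) (Φ.map Constr.wk) := by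
  intro c hc
  obtain ⟨c', hc', rfl⟩ := List.mem_map.1 hc
  simpa only [Constr.Holds, Constr.wk, Idx.den_wk] using h c' hc'

/-! ### A family of metrics -/

/-- The metric of a type when `ℝ[∞]`, which has no point at finite distance from itself, is
interpreted as the discrete metric space `P` of real numbers. For `P = ∅` this is `Ty.dist`. -/
def Ty.distOver (P : Set ℝ) :
    {φ : List Kind} → {A : STy} → Ty φ A → IEnv φ → A.den → A.den → ℝ≥0∞
  | _, _, .real, _ => fun (a b : ℝ) => ENNReal.ofReal |a - b|
  | _, _, .preal R, θ => fun (a b : ℝ) =>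
      open Classical in
      let ρ : ℝ≥0∞ := R.den θ
      if (ρ ≠ ⊤ ∧ a = ρ.toReal ∧ b = ρ.toReal) ∨ (ρ = ⊤ ∧ a = b ∧ a ∈ P) then 0 else ⊤
  | _, _, .list (A := A) σ S, θ => fun (l m : List A.den) =>
      let s : ℕ := S.den θ
      if l.length = s ∧ m.length = s then (List.zipWith (σ.distOver P θ) l m).sum else ⊤
  | _, _, .lolli R σ τ, θ => fun f g =>
      ⨆ a, ⨆ b, (τ.distOver P θ (f a) (g b) - distMul (R.den θ) (σ.distOver P θ a b))
  | _, _, .all κ σ, θ => fun f g =>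
      ⨆ d : κ.den, σ.distOver P (IEnv.cons d θ) (f d) (g d)
  | _, _, .mreal, _ => fun (μ ν : PMF ℝ) => ⨆ x : ℝ, logRatio (μ x) (ν x)

/-- The distance of valuations that belongs to `Ty.distOver P`. -/
def Ctx.distOver (P : Set ℝ) {φ : List Kind} (θ : IEnv φ) :
    {G : List STy} → Ctx φ G → Env G → Env G → ℝ≥0∞
  | _, .nil, _, _ => 0
  | _, .skip Γ, θ₁, θ₂ => Γ.distOver P θ θ₁.tail θ₂.tail
  | _, .cons Γ R σ, θ₁, θ₂ =>
      Γ.distOver P θ θ₁.tail θ₂.tail +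
        distMul (R.den θ) (σ.distOver P θ (θ₁ _ .zero) (θ₂ _ .zero))

theorem Ty.distOver_empty {φ : List Kind} {A : STy} (σ : Ty φ A) (θ : IEnv φ) :
    σ.distOver ∅ θ = σ.dist θ := by
  induction σ with
  | _ => simp only [Ty.distOver, Ty.dist, Set.mem_empty_iff_false, and_false, or_false, *]

theorem Ctx.distOver_empty {φ : List Kind} {G : List STy} (Γ : Ctx φ G) (θ : IEnv φ)
    (θ₁ θ₂ : Env G) : Γ.distOver ∅ θ θ₁ θ₂ = Γ.dist θ θ₁ θ₂ := by
  induction Γ with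
  | _ => simp only [Ctx.distOver, Ctx.dist, Ty.distOver_empty, *]

section

variable {P : Set ℝ} {φ : List Kind} {A B : STy}

theorem Ty.distOver_list_nil {σ : Ty φ A} {S : Idx φ .n} {θ : IEnv φ}
    (h : (S.den θ : ℕ) = 0) : (Ty.list σ S).distOver P θ [] [] = 0 := by
  simp [Ty.distOver, h]

theorem Ty.distOver_list_cons {σ : Ty φ A} {S : Idx φ .n} {S' : Idx φ .n} {θ : IEnv φ}
    (h : (S.den θ : ℕ) = (S'.den θ : ℕ) + 1) (a b : A.den) (l m : List A.den) :
    (Ty.list σ S).distOver P θ (a :: l) (b :: m) =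
      σ.distOver P θ a b + (Ty.list σ S').distOver P θ l m := by
  simp only [Ty.distOver, List.length_cons, h, Nat.add_right_cancel_iff, List.zipWith_cons_cons,
    List.sum_cons]
  split_ifs <;> simp

theorem Ty.length_eq_of_distOver_ne_top {σ : Ty φ A} {S : Idx φ .n} {θ : IEnv φ}
    {l m : List A.den} (h : (Ty.list σ S).distOver P θ l m ≠ ⊤) :
    l.length = S.den θ ∧ m.length = S.den θ := by
  by_contra h'
  exact h (if_neg h')

theorem Ty.distOver_lolli_le_iff {R : Idx φ .r} {σ : Ty φ A} {τ : Ty φ B} {θ : IEnv φ}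
    {f g : A.den → B.den} {ε : ℝ≥0∞} :
    (Ty.lolli R σ τ).distOver P θ f g ≤ ε ↔
      ∀ a b, τ.distOver P θ (f a) (g b) ≤ ε + distMul (R.den θ) (σ.distOver P θ a b) := by
  simp only [Ty.distOver, iSup_le_iff, tsub_le_iff_right]

theorem Ty.distOver_all_le_iff {κ : Kind} {σ : Ty (κ :: φ) A} {θ : IEnv φ}
    {f g : κ.den → A.den} {ε : ℝ≥0∞} :
    (Ty.all κ σ).distOver P θ f g ≤ ε ↔
      ∀ d, σ.distOver P (IEnv.cons d θ) (f d) (g d) ≤ ε := by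
  simp only [Ty.distOver, iSup_le_iff]

theorem Ty.distOver_subst (σ : Ty φ A) :
    ∀ {ψ : List Kind} (s : ISub φ ψ) (θ : IEnv ψ),
      (σ.subst s).distOver P θ = σ.distOver P (fun κ i => (s κ i).den θ) := by
  induction σ with
  | preal R => intro ψ s θ; simp only [Ty.subst, Ty.distOver]; rw [Idx.den_subst]
  | _ => intro ψ s θ; simp only [Ty.subst, Ty.distOver, Idx.den_subst, ISub.den_lift, *]

theorem Ty.distOver_wk {κ : Kind} (σ : Ty φ A) (d : κ.den) (θ : IEnv φ) :
    σ.wk.distOver P (IEnv.cons d θ) = σ.distOver P θ :=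
  Ty.distOver_subst _ _ _

theorem Ctx.distOver_wk {κ : Kind} {G : List STy} (Γ : Ctx φ G) (d : κ.den) (θ : IEnv φ)
    (θ₁ θ₂ : Env G) : Γ.wk.distOver P (IEnv.cons d θ) θ₁ θ₂ = Γ.distOver P θ θ₁ θ₂ := by
  induction Γ with
  | _ => simp only [Ctx.wk, Ctx.distOver, Idx.den_wk, Ty.distOver_wk, *]

theorem Ctx.distOver_sum {G : List STy} {Γ Γ' Γ'' : Ctx φ G} (h : Ctx.Sum Γ Γ' Γ'')
    (θ : IEnv φ) (θ₁ θ₂ : Env G) :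
    Γ''.distOver P θ θ₁ θ₂ = Γ.distOver P θ θ₁ θ₂ + Γ'.distOver P θ θ₁ θ₂ := by
  induction h with
  | nil => simp [Ctx.distOver]
  | skip _ ih => simp only [Ctx.distOver, ih]
  | left _ ih => simp only [Ctx.distOver, ih]; ring
  | right _ ih => simp only [Ctx.distOver, ih]; ring
  | both _ ih => simp only [Ctx.distOver, ih, Idx.den, add_distMul]; ring

theorem Ctx.distMul_distOver_le {G : List STy} (Γ : Ctx φ G) (R : Idx φ .r) (θ : IEnv φ)
    (θ₁ θ₂ : Env G) :
    distMul (R.den θ) (Γ.distOver P θ θ₁ θ₂) ≤ (Γ.scale R).distOver P θ θ₁ θ₂ := by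
  induction Γ with
  | nil => simp [Ctx.distOver, distMul_zero]
  | skip Γ ih => exact ih _ _
  | cons Γ R' σ ih =>
    simp only [Ctx.scale, Ctx.distOver, distMul_add]
    exact add_le_add (ih _ _) (distMul_distMul_le _ _ _)

theorem Ctx.Has.distOver_le {G : List STy} {Γ : Ctx φ G} {x : Var G A} {R : Idx φ .r}
    {σ : Ty φ A} (h : Γ.Has x R σ) (θ : IEnv φ) (θ₁ θ₂ : Env G) :
    distMul (R.den θ) (σ.distOver P θ (θ₁ _ x) (θ₂ _ x)) ≤ Γ.distOver P θ θ₁ θ₂ := by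
  induction h with
  | here => exact le_add_self
  | skip _ ih => exact ih _ _
  | cons _ ih => exact (ih _ _).trans le_self_add

theorem Sub.distOver_le {Φ : List (Constr φ)} {σ τ : Ty φ A} (h : Sub Φ σ τ) :
    ∀ {θ : IEnv φ}, Models θ Φ → ∀ a b, τ.distOver P θ a b ≤ σ.distOver P θ a b := by
  induction h with
  | real => intro θ _ a b; exact le_rfl
  | mreal => intro θ _ a b; exact le_rfl
  | preal h => intro θ hθ a b; simp only [Ty.distOver]; rw [h θ hθ]
  | forget =>
    intro θ _ (a : ℝ) (b : ℝ)
    simp only [Ty.distOver]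
    split_ifs with h
    · have hab : a = b := by
        rcases h with ⟨_, ha, hb⟩ | ⟨_, hab, _⟩
        · rw [ha, hb]
        · exact hab
      simp [hab]
    · exact le_top
  | list _ hS ih =>
    rename_i φ' Φ' A' σ σ' S S' _
    intro θ hθ l m
    simp only [Ty.distOver, hS θ hθ]
    split_ifs with hlen
    · clear hlen
      change List A'.den at l m
      induction l generalizing m with
      | nil => simp
      | cons a l ihl =>
        cases m with
        | nil => simp
        | cons b m =>
          simp only [List.zipWith_cons_cons, List.sum_cons]
          exact add_le_add (ih hθ a b) (ihl m)
    · exact le_rfl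
  | lolli hR _ _ ihσ ihτ =>
    intro θ hθ f g
    rw [Ty.distOver_lolli_le_iff]
    intro a b
    exact (ihτ hθ _ _).trans ((Ty.distOver_lolli_le_iff.1 le_rfl a b).trans
      (add_le_add le_rfl (distMul_mono (hR θ hθ) (ihσ hθ a b))))
  | all _ ih =>
    intro θ hθ f g
    rw [Ty.distOver_all_le_iff]
    exact fun d => (ih (hθ.cons_wk d) _ _).trans (Ty.distOver_all_le_iff.1 le_rfl d)

theorem Ctx.Sub.distOver_le {Φ : List (Constr φ)} {G : List STy} {Γ Γ' : Ctx φ G}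
    (h : Ctx.Sub Φ Γ Γ') {θ : IEnv φ} (hθ : Models θ Φ) (θ₁ θ₂ : Env G) :
    Γ'.distOver P θ θ₁ θ₂ ≤ Γ.distOver P θ θ₁ θ₂ := by
  induction h with
  | nil => exact le_rfl
  | skip _ ih => exact ih _ _
  | weaken _ ih => exact (ih _ _).trans le_self_add
  | cons _ hR hσ ih =>
    exact add_le_add (ih _ _) (distMul_mono (hR θ hθ) (hσ.distOver_le hθ _ _))

end

/-! ### Distances of probability distributions -/

theorem logRatio_self {p : ℝ≥0∞} (hp : p ≠ ⊤) : logRatio p p = 0 := by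
  by_cases h : p = 0
  · simp [logRatio, h]
  · simp [logRatio, h, div_self (ENNReal.toReal_ne_zero.2 ⟨h, hp⟩)]

theorem logRatio_le_iff {p q : ℝ≥0∞} (hp : p ≠ ⊤) (hq : q ≠ ⊤) {ε : ℝ≥0∞} (hε : ε ≠ ⊤) :
    logRatio p q ≤ ε ↔ p ≤ ENNReal.ofReal (Real.exp ε.toReal) * q ∧
      q ≤ ENNReal.ofReal (Real.exp ε.toReal) * p := by
  have hE := Real.exp_pos ε.toReal
  by_cases hp0 : p = 0
  · by_cases hq0 : q = 0
    · simp [logRatio, hp0, hq0]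
    · simp [logRatio, hp0, hq0, hε]
  by_cases hq0 : q = 0
  · simp [logRatio, hp0, hq0, hε]
  lift p to ℝ≥0 using hp
  lift q to ℝ≥0 using hq
  have hp' : (0 : ℝ) < p := by
    have : p ≠ 0 := by simpa using hp0
    positivity
  have hq' : (0 : ℝ) < q := by
    have : q ≠ 0 := by simpa using hq0
    positivity
  have key : ∀ x y : ℝ≥0, (x : ℝ≥0∞) ≤ ENNReal.ofReal (Real.exp ε.toReal) * y ↔
      (x : ℝ) ≤ Real.exp ε.toReal * y := by
    intro x y
    rw [← ENNReal.ofReal_coe_nnreal (p := x), ← ENNReal.ofReal_coe_nnreal (p := y),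
      ← ENNReal.ofReal_mul hE.le, ENNReal.ofReal_le_ofReal_iff (by positivity)]
  rw [key, key]
  simp only [logRatio, hp0, hq0, and_self, or_self, if_false]
  rw [ENNReal.ofReal_le_iff_le_toReal hε, abs_le, ENNReal.coe_toReal, ENNReal.coe_toReal,
    Real.log_le_iff_le_exp (by positivity), Real.le_log_iff_exp_le (by positivity),
    div_le_iff₀ hq', le_div_iff₀ hq', Real.exp_neg, inv_mul_le_iff₀ hE, and_comm]

theorem logRatio_bind_le {α β : Type} {μ ν : PMF α} {k l : α → PMF β} {ε δ : ℝ≥0∞}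
    (h : ∀ a, logRatio (μ a) (ν a) ≤ ε) (h' : ∀ a b, logRatio (k a b) (l a b) ≤ δ) (b : β) :
    logRatio ((μ.bind k) b) ((ν.bind l) b) ≤ ε + δ := by
  by_cases hε : ε = ⊤
  · simp [hε]
  by_cases hδ : δ = ⊤
  · simp [hδ]
  rw [logRatio_le_iff (PMF.apply_ne_top _ _) (PMF.apply_ne_top _ _)
    (ENNReal.add_ne_top.2 ⟨hε, hδ⟩), ENNReal.toReal_add hε hδ, Real.exp_add,
    ENNReal.ofReal_mul (Real.exp_pos _).le]
  have h₁ a := (logRatio_le_iff (PMF.apply_ne_top _ _) (PMF.apply_ne_top _ _) hε).1 (h a)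
  have h₂ a := (logRatio_le_iff (PMF.apply_ne_top _ _) (PMF.apply_ne_top _ _) hδ).1 (h' a b)
  simp only [PMF.bind_apply, ← ENNReal.tsum_mul_left]
  constructor <;> refine ENNReal.tsum_le_tsum fun a => ?_
  · exact (mul_le_mul' (h₁ a).1 (h₂ a).1).trans_eq (by ring)
  · exact (mul_le_mul' (h₁ a).2 (h₂ a).2).trans_eq (by ring)

/-! ### Limits of unfoldings -/

theorem fixpoint_isUnion {A B : STy} {F : (STy.fn A B).den → (STy.fn A B).den}
    (h : ∃ d, IsUnion F d) : IsUnion F (fixpoint F) := by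
  rw [fixpoint, dif_pos h]
  exact h.choose_spec

/-- `Stabilizes B v d`: the sequence `v` is eventually equal to `d`, pointwise at function
types. -/
def Stabilizes : (B : STy) → (ℕ → B.den) → B.den → Prop
  | .fn A B, v, d => ∀ a : A.den, Stabilizes B (fun k => v k a) (d a)
  | .idx _, v, d => ∃ k, ∀ n, k ≤ n → v n = d
  | .real, v, d => ∃ k, ∀ n, k ≤ n → v n = d
  | .list _, v, d => ∃ k, ∀ n, k ≤ n → v n = d
  | .dist, v, d => ∃ k, ∀ n, k ≤ n → v n = d

theorem eventually_eq_of_settled {X α : Type} {u : ℕ → X → α} {F : X → X}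
    (hu : ∀ k g, u (k + 1) g = u k (F g)) {d : α} (h : ∃ k, ∀ g, u k g = d) (g : X) :
    ∃ k, ∀ n, k ≤ n → u n g = d := by
  obtain ⟨k, hk⟩ := h
  refine ⟨k, fun n hn => ?_⟩
  induction n, hn using Nat.le_induction generalizing g with
  | base => exact hk g
  | succ n _ ih => rw [hu]; exact ih (F g)

/-- The stages from any start `g` stabilize, since stage `k + 1` at `g` is stage `k` at `F g`. -/
theorem Settles.stabilizes {X : Type} {F : X → X} (g : X) :
    ∀ {B : STy} {u : ℕ → X → B.den} {d : B.den}, (∀ k g, u (k + 1) g = u k (F g)) →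
      Settles B u d → Stabilizes B (fun k => u k g) d
  | .fn _ _, _, _, hu, h => fun a =>
      Settles.stabilizes g (fun k g => congrFun (hu k g) a) (h a)
  | .idx _, _, _, hu, h => eventually_eq_of_settled hu h g
  | .real, _, _, hu, h => eventually_eq_of_settled hu h g
  | .list _, _, _, hu, h => eventually_eq_of_settled hu h g
  | .dist, _, _, hu, h => eventually_eq_of_settled hu h g

theorem IsUnion.stabilizes {A B : STy} {F : (STy.fn A B).den → (STy.fn A B).den}
    {d : (STy.fn A B).den} (h : IsUnion F d) (g : (STy.fn A B).den) :
    Stabilizes (.fn A B) (fun k => F^[k] g) d :=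
  Settles.stabilizes (F := F) (u := fun k g => F^[k] g) g
    (fun k g => Function.iterate_succ_apply F k g) h

theorem le_of_eventually_eq {α : Type} {D : α → α → ℝ≥0∞} {v w : ℕ → α} {a b : α} {ε : ℝ≥0∞}
    (hv : ∃ k, ∀ n, k ≤ n → v n = a) (hw : ∃ k, ∀ n, k ≤ n → w n = b)
    (h : ∀ k, D (v k) (w k) ≤ ε) : D a b ≤ ε := by
  obtain ⟨i, hi⟩ := hv
  obtain ⟨j, hj⟩ := hw
  simpa only [hi _ (le_max_left i j), hj _ (le_max_right i j)] using h (max i j)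

theorem Stabilizes.distOver_le {P : Set ℝ} {φ : List Kind} {A : STy} (σ : Ty φ A) :
    ∀ {θ : IEnv φ} {v w : ℕ → A.den} {a b : A.den} {ε : ℝ≥0∞}, Stabilizes A v a →
      Stabilizes A w b → (∀ k, σ.distOver P θ (v k) (w k) ≤ ε) → σ.distOver P θ a b ≤ ε := by
  induction σ with
  | lolli R σ τ _ ih =>
    intro θ v w f g ε hv hw h
    rw [Ty.distOver_lolli_le_iff]
    exact fun a b => ih (hv a) (hw b) fun k => Ty.distOver_lolli_le_iff.1 (h k) a b
  | all κ σ ih =>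
    intro θ v w f g ε hv hw h
    rw [Ty.distOver_all_le_iff]
    exact fun d => ih (hv d) (hw d) fun k => Ty.distOver_all_le_iff.1 (h k) d
  | _ => intro θ v w a b ε hv hw h; exact le_of_eventually_eq hv hw h

/-! ### Types without self-related elements -/

/-- An element of `σ` that has distance `0` from itself for every interpretation of `ℝ[∞]`. -/
def Ty.IsUniform {φ : List Kind} {A : STy} (σ : Ty φ A) (θ : IEnv φ) (v : A.den) : Prop :=
  ∀ P, σ.distOver P θ v v = 0

/-- The type `σ` behaves like `ℝ[∞]`: elements at finite distance determine a point of the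
interpretation `P` of `ℝ[∞]`, which `out` extracts, and every point of `P` gives, through `inn`,
an element at distance `0` from itself. -/
structure Ty.IsPointed {φ : List Kind} {A : STy} (σ : Ty φ A) (θ : IEnv φ) (out : A.den → ℝ)
    (inn : ℝ → A.den) : Prop where
  out_eq : ∀ {P a b}, σ.distOver P θ a b ≠ ⊤ → out a = out b ∧ out a ∈ P
  inn_dist : ∀ {P c}, c ∈ P → σ.distOver P θ (inn c) (inn c) = 0

theorem Ty.distOver_replicate {P : Set ℝ} {φ : List Kind} {A : STy} {σ : Ty φ A} {θ : IEnv φ}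
    {v : A.den} (h : σ.distOver P θ v v = 0) (S : Idx φ .n) :
    (Ty.list σ S).distOver P θ (List.replicate (S.den θ) v) (List.replicate (S.den θ) v) = 0 := by
  simp [Ty.distOver, h]

/-- Read `ℝ[∞]` as a propositional atom: a formula built from one atom and truth by
conjunction and implication is equivalent either to truth or to the atom. -/
theorem Ty.isUniform_or_isPointed {φ : List Kind} {A : STy} (σ : Ty φ A) (θ : IEnv φ) :
    (∃ v, σ.IsUniform θ v) ∨ ∃ out inn, σ.IsPointed θ out inn := by
  induction σ with
  | real => exact .inl ⟨(0 : ℝ), fun P => by simp [Ty.distOver]⟩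
  | preal R =>
    by_cases h : (R.den θ : ℝ≥0∞) = ⊤
    · refine .inr ⟨fun a => a, fun c => c, ⟨fun {P a b} hab => ?_, fun {P c} hc => ?_⟩⟩
      · by_contra h'
        refine hab (if_neg ?_)
        rintro (⟨h₁, _⟩ | ⟨_, rfl, h₂⟩)
        · exact h₁ h
        · exact h' ⟨rfl, h₂⟩
      · exact if_pos (.inr ⟨h, rfl, hc⟩)
    · exact .inl ⟨(R.den θ : ℝ≥0∞).toReal, fun P => if_pos (.inl ⟨h, rfl, rfl⟩)⟩
  | @list φ A σ S ih =>
    rcases hS : (S.den θ : ℕ) with _ | n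
    · exact .inl ⟨[], fun P => Ty.distOver_list_nil hS⟩
    rcases ih θ with ⟨v, hv⟩ | ⟨out, inn, h⟩
    · exact .inl ⟨_, fun P => Ty.distOver_replicate (hv P) S⟩
    refine .inr ⟨fun l : List A.den => out (l.headD A.default),
      fun c => List.replicate (S.den θ) (inn c),
      ⟨fun {P} l m hlm => ?_, fun hc => Ty.distOver_replicate (h.inn_dist hc) S⟩⟩
    change List A.den at l m
    obtain ⟨hl, hm⟩ := Ty.length_eq_of_distOver_ne_top hlm
    match l, m with
    | [], _ => simp [hS] at hl
    | _ :: _, [] => simp [hS] at hm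
    | a :: l, b :: m =>
      refine h.out_eq (P := P) fun hab => hlm ?_
      replace hab : σ.distOver P θ a b = ⊤ := hab
      simp [Ty.distOver, hl, hm, hab]
  | lolli R σ τ ihσ ihτ =>
    rcases ihτ θ with ⟨v, hv⟩ | ⟨out, inn, h⟩
    · refine .inl ⟨fun _ => v, fun P => le_antisymm ?_ zero_le⟩
      rw [Ty.distOver_lolli_le_iff]
      exact fun a b => (hv P).trans_le zero_le
    rcases ihσ θ with ⟨a, ha⟩ | ⟨out', inn', h'⟩
    -- Truth implies the atom: equivalent to the atom.
    · refine .inr ⟨fun f => out (f a), fun c _ => inn c,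
        ⟨fun {P f g} hfg => h.out_eq (P := P) (ne_top_of_le_ne_top hfg ?_), fun {P c} hc => ?_⟩⟩
      · simpa only [ha P, distMul_zero, add_zero] using
          Ty.distOver_lolli_le_iff.1 (le_refl ((Ty.lolli R σ τ).distOver P θ f g)) a a
      · refine le_antisymm ?_ zero_le
        rw [Ty.distOver_lolli_le_iff]
        exact fun _ _ => (h.inn_dist hc).trans_le zero_le
    -- The atom implies the atom: true, and the witness transports the point.
    · refine .inl ⟨fun a => inn (out' a), fun P => le_antisymm ?_ zero_le⟩
      rw [Ty.distOver_lolli_le_iff]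
      intro a b
      by_cases hab : σ.distOver P θ a b = ⊤
      · simp [hab, distMul_top_right]
      · obtain ⟨h₁, h₂⟩ := h'.out_eq hab
        rw [← h₁, h.inn_dist h₂]
        exact zero_le
  | all κ σ ih =>
    by_cases hall : ∀ d, ∃ v, σ.IsUniform (IEnv.cons d θ) v
    · choose v hv using hall
      refine .inl ⟨v, fun P => le_antisymm ?_ zero_le⟩
      rw [Ty.distOver_all_le_iff]
      exact fun d => (hv d P).le
    push Not at hall
    obtain ⟨d₀, hd₀⟩ := hall
    obtain ⟨out, _, h⟩ := (ih (IEnv.cons d₀ θ)).resolve_left fun ⟨v, hv⟩ => hd₀ v hv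
    have hinn : ∀ c d, ∃ v, ∀ P : Set ℝ, c ∈ P → σ.distOver P (IEnv.cons d θ) v v = 0 := by
      intro c d
      rcases ih (IEnv.cons d θ) with ⟨v, hv⟩ | ⟨_, inn', h'⟩
      · exact ⟨v, fun P _ => hv P⟩
      · exact ⟨inn' c, fun P hc => h'.inn_dist hc⟩
    choose inn hinn using hinn
    refine .inr ⟨fun f => out (f d₀), inn,
      ⟨fun {P f g} hfg => h.out_eq (P := P) (ne_top_of_le_ne_top hfg ?_), fun {P c} hc => ?_⟩⟩
    · exact Ty.distOver_all_le_iff.1 le_rfl d₀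
    · refine le_antisymm ?_ zero_le
      rw [Ty.distOver_all_le_iff]
      exact fun d => (hinn c d P hc).le
  | mreal =>
    exact .inl ⟨PMF.pure 0, fun P => by
      simp only [Ty.distOver, ENNReal.iSup_eq_zero]
      exact fun x => logRatio_self (PMF.apply_ne_top _ _)⟩

/-- Valuations at finite distance exist only if no declared type is pointed. -/
theorem Ctx.exists_isUniform {φ : List Kind} {G : List STy} {Γ : Ctx φ G} {θ : IEnv φ}
    {θ₁ θ₂ : Env G} (h : Γ.distOver ∅ θ θ₁ θ₂ ≠ ⊤) :
    ∃ η : Env G, ∀ P, Γ.distOver P θ η η = 0 := by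
  induction Γ with
  | nil => exact ⟨θ₁, fun P => rfl⟩
  | @skip G A Γ ih =>
    obtain ⟨η, hη⟩ := ih h
    exact ⟨Env.cons A.default η, hη⟩
  | cons Γ R σ ih =>
    obtain ⟨h₁, h₂⟩ := ENNReal.add_ne_top.1 h
    obtain ⟨η, hη⟩ := ih h₁
    rcases σ.isUniform_or_isPointed θ with ⟨v, hv⟩ | ⟨_, _, hσ⟩
    · refine ⟨Env.cons v η, fun P => ?_⟩
      change Γ.distOver P θ η η + distMul (R.den θ) (σ.distOver P θ v v) = 0
      rw [hη, hv, distMul_zero, add_zero]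
    · exact absurd (hσ.out_eq fun h' => h₂ (by rw [h', distMul_top_right])).2
        (Set.notMem_empty _)

/-! ### Recursive definitions -/

section

variable {φ : List Kind} {G : List STy} {A B : STy} {σ : Ty φ (.fn A B)} {Γ : Ctx φ G}
  {θ : IEnv φ}

theorem distOver_fixpoint_eq_zero {P : Set ℝ} {F F' : (STy.fn A B).den → (STy.fn A B).den}
    (hF : ∃ d, IsUnion F d) (hF' : ∃ d, IsUnion F' d)
    (step : ∀ f g, σ.distOver P θ f g = 0 → σ.distOver P θ (F f) (F' g) = 0)
    {g : (STy.fn A B).den} (hg : σ.distOver P θ g g = 0) :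
    σ.distOver P θ (fixpoint F) (fixpoint F') = 0 := by
  refine le_antisymm (Stabilizes.distOver_le σ ((fixpoint_isUnion hF).stabilizes g)
    ((fixpoint_isUnion hF').stabilizes g) fun k => le_of_eq ?_) zero_le
  induction k with
  | zero => exact hg
  | succ k ih => simpa only [Function.iterate_succ_apply'] using step _ _ ih

/-- The metric bound for a recursive definition with body `F`. If `σ` is pointed and `P = ∅`, there
is no element from which to start the unfolding, and no valuations are at finite distance:
otherwise there is a valuation that is uniform in `P`, and the bound for `P = {0}` and `P = {1}`,
where unfolding can start, says that the recursive function determines both points. -/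
theorem distOver_fixpoint_le {F : Env G → (STy.fn A B).den → (STy.fn A B).den}
    (hF : ∀ η, ∃ d, IsUnion (F η) d)
    (step : ∀ P η₁ η₂ f g, σ.distOver P θ (F η₁ f) (F η₂ g) ≤
      Γ.distOver P θ η₁ η₂ + distMul ⊤ (σ.distOver P θ f g))
    (P : Set ℝ) (η₁ η₂ : Env G) :
    σ.distOver P θ (fixpoint (F η₁)) (fixpoint (F η₂)) ≤
      distMul ⊤ (Γ.distOver P θ η₁ η₂) := by
  have main : ∀ {P η₁ η₂ g}, Γ.distOver P θ η₁ η₂ = 0 → σ.distOver P θ g g = 0 →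
      σ.distOver P θ (fixpoint (F η₁)) (fixpoint (F η₂)) = 0 := by
    intro P η₁ η₂ g hΓ hg
    refine distOver_fixpoint_eq_zero (hF _) (hF _) (fun f g hfg => ?_) hg
    simpa only [hΓ, hfg, distMul_zero, add_zero, nonpos_iff_eq_zero] using step P η₁ η₂ f g
  by_cases hΓ : Γ.distOver P θ η₁ η₂ = 0
  swap
  · rw [distMul_top_of_ne_zero hΓ]
    exact le_top
  rw [hΓ, distMul_zero, nonpos_iff_eq_zero]
  rcases σ.isUniform_or_isPointed θ with ⟨v, hv⟩ | ⟨out, inn, hσ⟩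
  · exact main hΓ (hv P)
  rcases P.eq_empty_or_nonempty with rfl | ⟨c, hc⟩
  · obtain ⟨η, hη⟩ := Ctx.exists_isUniform (hΓ.trans_ne ENNReal.zero_ne_top)
    have hout : ∀ c : ℝ, out (fixpoint (F η)) = c := fun c =>
      (hσ.out_eq (P := {c})
        ((main (hη _) (hσ.inn_dist (Set.mem_singleton c))).trans_ne ENNReal.zero_ne_top)).2
    exact absurd ((hout 0).symm.trans (hout 1)) zero_ne_one
  · exact main hΓ (hσ.inn_dist hc)

end

/-! ### Metric preservation -/

theorem HasType.distOver_sem_le {φ : List Kind} {Φ : List (Constr φ)} {G : List STy}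
    {Γ : Ctx φ G} {A : STy} {e : Exp φ G A} {τ : Ty φ A} (h : HasType Φ Γ e τ) :
    ∀ (P : Set ℝ) {θ : IEnv φ}, Models θ Φ → ∀ θ₁ θ₂ : Env G,
      τ.distOver P θ (e.sem θ₁ θ) (e.sem θ₂ θ) ≤ Γ.distOver P θ θ₁ θ₂ := by
  induction h with
  | var hx =>
    intro P θ _ θ₁ θ₂
    refine le_trans (le_of_eq ?_) (hx.distOver_le θ θ₁ θ₂)
    simp [Idx.den, distMul_one, Exp.sem]
  | num =>
    intro P θ _ θ₁ θ₂
    refine le_trans (le_of_eq (if_pos (.inl ?_))) zero_le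
    simp [Idx.den, Exp.sem]
  | lam _ ih =>
    intro P θ hθ θ₁ θ₂
    rw [Ty.distOver_lolli_le_iff]
    exact fun a b => ih P hθ (Env.cons a θ₁) (Env.cons b θ₂)
  | app _ _ hsum ih₁ ih₂ =>
    intro P θ hθ θ₁ θ₂
    rw [Ctx.distOver_sum hsum]
    refine (Ty.distOver_lolli_le_iff.1 (ih₁ P hθ θ₁ θ₂) _ _).trans (add_le_add le_rfl ?_)
    exact (distMul_mono le_rfl (ih₂ P hθ θ₁ θ₂)).trans (Ctx.distMul_distOver_le _ _ _ _ _)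
  | letrec _ hg ih =>
    intro P θ hθ θ₁ θ₂
    refine le_trans (distOver_fixpoint_le
      (fun η => Exp.exists_isUnion_of_letrec_guard hg η θ) (fun P η₁ η₂ f g => ?_) P θ₁ θ₂)
      (Ctx.distMul_distOver_le _ .infty _ _ _)
    rw [Ty.distOver_lolli_le_iff]
    exact fun a b => ih P hθ (Env.cons a (Env.cons (A := .fn _ _) f η₁))
      (Env.cons b (Env.cons (A := .fn _ _) g η₂))
  | letrecI _ hg ih =>
    intro P θ hθ θ₁ θ₂
    refine le_trans (distOver_fixpoint_le
      (fun η => Exp.exists_isUnion_of_letrecI_guard hg η θ) (fun P η₁ η₂ f g => ?_) P θ₁ θ₂)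
      (Ctx.distMul_distOver_le _ .infty _ _ _)
    rw [Ty.distOver_all_le_iff]
    intro d
    refine (ih P (hθ.cons_wk d) (Env.cons (A := .fn (.idx _) _) f η₁)
      (Env.cons (A := .fn (.idx _) _) g η₂)).trans_eq ?_
    simp only [Ctx.distOver, Ty.distOver_wk]
    congr 1
    exact Ctx.distOver_wk _ _ _ _ _
  | ilam _ ih =>
    intro P θ hθ θ₁ θ₂
    rw [Ty.distOver_all_le_iff]
    exact fun d => (ih P (hθ.cons_wk d) θ₁ θ₂).trans_eq (Ctx.distOver_wk _ _ _ _ _)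
  | iapp _ ih =>
    intro P θ hθ θ₁ θ₂
    rw [Ty.distOver_subst, ISub.den_inst]
    exact Ty.distOver_all_le_iff.1 (ih P hθ θ₁ θ₂) _
  | nil =>
    intro P θ _ θ₁ θ₂
    exact (Ty.distOver_list_nil rfl).trans_le zero_le
  | cons _ _ hsum ih ih' =>
    intro P θ hθ θ₁ θ₂
    rw [Ctx.distOver_sum hsum]
    exact (Ty.distOver_list_cons rfl _ _ _ _).trans_le
      (add_le_add (ih P hθ θ₁ θ₂) (ih' P hθ θ₁ θ₂))
  | @case φ Φ G Γ Γ' Γ'' A B e e₁ e₂ σ τ S R _ _ _ hsum ih ih₁ ih₂ =>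
    intro P θ hθ θ₁ θ₂
    rw [Ctx.distOver_sum hsum]
    refine le_trans ?_ (add_le_add le_rfl ((distMul_mono le_rfl (ih P hθ θ₁ θ₂)).trans
      (Ctx.distMul_distOver_le _ R _ _ _)))
    -- Finite distance forces both lists to have length `S`, so that they select the same branch
    -- and give the same value to its size variable.
    by_cases htop : (Ty.list σ S).distOver P θ (e.sem θ₁ θ) (e.sem θ₂ θ) = ⊤
    · simp [htop, distMul_top_right]
    obtain ⟨hl, hm⟩ := Ty.length_eq_of_distOver_ne_top htop
    simp only [Exp.sem]
    generalize (e.sem θ₁ θ : List A.den) = l at *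
    generalize (e.sem θ₂ θ : List A.den) = m at *
    match l, m with
    | [], [] =>
      refine (ih₁ P (List.forall_mem_cons.2 ⟨hl.symm, hθ⟩) θ₁ θ₂).trans le_self_add
    | [], _ :: _ => exact absurd (hl.trans hm.symm) (by simp)
    | _ :: _, [] => exact absurd (hl.trans hm.symm) (by simp)
    | x :: xs, y :: ys =>
      have hlen : ys.length = xs.length := by simpa using hm.trans hl.symm
      have hS : Constr.Holds (IEnv.cons (κ := .n) xs.length θ)
          ⟨S.subst ISub.wk, .succ (.var .zero)⟩ := (Idx.den_wk _ _ _).trans hl.symm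
      have hcons : (Ty.list σ S).distOver P θ (x :: xs) (y :: ys) =
          σ.distOver P θ x y + (Ty.list σ.wk (.var .zero)).distOver P
            (IEnv.cons (κ := .n) xs.length θ) xs ys := by
        rw [← Ty.distOver_wk (Ty.list σ S) (κ := .n) xs.length θ,
          ← Ty.distOver_wk σ (κ := .n) xs.length θ]
        exact Ty.distOver_list_cons hS x y xs ys
      have hbranch := ih₂ P (List.forall_mem_cons.2 ⟨hS, hθ.cons_wk (κ := .n) xs.length⟩)
        (Env.cons (A := .list A) xs (Env.cons x θ₁)) (Env.cons (A := .list A) ys (Env.cons y θ₂))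
      rw [Ty.distOver_wk] at hbranch
      rw [hcons, distMul_add, ← add_assoc]
      simp only [hlen]
      refine hbranch.trans_eq ?_
      simp only [Ctx.distOver, Idx.den_wk, Ty.distOver_wk, Ctx.distOver_wk]
      rfl
  | @ret φ Φ G Γ e _ ih =>
    intro P θ hθ θ₁ θ₂
    refine le_trans ?_ (Ctx.distMul_distOver_le _ .infty _ _ _)
    -- Scaling by `∞` leaves only the case of distance `0`, where the two returned reals agree.
    by_cases hΓ : Γ.distOver P θ θ₁ θ₂ = 0
    · have hdist := ih P hθ θ₁ θ₂
      rw [hΓ] at hdist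
      have heq : (e.sem θ₁ θ : ℝ) = e.sem θ₂ θ := by
        simpa [Ty.distOver, sub_eq_zero] using hdist
      simp only [Ty.distOver, Exp.sem, heq, logRatio_self (PMF.apply_ne_top _ _), iSup_const]
      exact zero_le
    · refine le_top.trans_eq (distMul_top_of_ne_zero hΓ).symm
  | bind _ _ hsum ih ih' =>
    intro P θ hθ θ₁ θ₂
    rw [Ctx.distOver_sum hsum]
    refine iSup_le fun y => logRatio_bind_le
      (fun a => (le_iSup (fun x : ℝ => logRatio _ _) a).trans (ih P hθ θ₁ θ₂)) (fun a b => ?_) y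
    -- The argument `a` is the same on both sides, so its infinite sensitivity costs nothing.
    refine (le_iSup (fun x : ℝ => logRatio _ _) b).trans ((ih' P hθ (Env.cons (A := .real) a θ₁)
      (Env.cons (A := .real) a θ₂)).trans_eq ?_)
    have haa : (Ty.real : Ty _ _).distOver P θ a a = 0 := by simp [Ty.distOver]
    change _ + distMul _ ((Ty.real : Ty _ _).distOver P θ a a) = _
    rw [haa, distMul_zero, add_zero]
    rfl
  | sub _ hΓ hτ ih =>
    intro P θ hθ θ₁ θ₂
    exact (hτ.distOver_le hθ _ _).trans ((ih P hθ θ₁ θ₂).trans (hΓ.distOver_le hθ θ₁ θ₂))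

end DFuzz

end

theorem mainTheorem5 {φ : List DFuzz.Kind} {G : List DFuzz.STy} {A : DFuzz.STy}
    (Φ : List (DFuzz.Constr φ)) (Γ : DFuzz.Ctx φ G) (e : DFuzz.Exp φ G A) (τ : DFuzz.Ty φ A)
    (he : DFuzz.HasType Φ Γ e τ)
    (θ : DFuzz.IEnv φ) (hθ : DFuzz.Models θ Φ) (θ₁ θ₂ : DFuzz.Env G) :
    τ.dist θ (e.interp θ₁ θ) (e.interp θ₂ θ) ≤ Γ.dist θ θ₁ θ₂ := by
  rw [DFuzz.Exp.interp_eq_sem, DFuzz.Exp.interp_eq_sem, ← DFuzz.Ty.distOver_empty,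
    ← DFuzz.Ctx.distOver_empty]
  exact he.distOver_sem_le ∅ hθ θ₁ θ₂
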